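/- **Setting.** Let $d,K\ge 1$ be integers, $R\ge 0$, $L,B\ge 1$, $\zeta\ge 0$, $\Delta>0$, $0<\delta<1$. In round $k=1,\dots,K$ a decision set $\mathcal D_k\subset\mathbb R^d$ is presented, the learner picks $x_k\in\mathcal D_k$ and observes $r_k=r(x_k)+\varepsilon_k$, where the decisions of round $k$ are made before $\varepsilon_k$ and, conditionally on the past, $\varepsilon_k$ is $R$-sub-Gaussian: $\mathbb E[e^{t\varepsilon_k}\mid\text{past}]\le e^{t^2R^2/2}$ for all $t\in\mathbb R$. Every arm $x\in\bigcup_k\mathcal D_k$ satisfies $\|x\|_2\le L$, $r(x)\in[0,1]$ and $|r(x)-x^\top\theta^*|\le\zeta$, where $\|\theta^*\|_2\le B$. Put $r_k^*=\max_{x\in\mathcal D_k}r(x)$ and $\mathrm{Regret}(K)=\sum_{k=1}^K(r_k^*-r(x_k))$. Suppose that every positive gap $r^*_k-r(x)$ ($k\le K$, $x\in\mathcal D_k$) is at least $\Delta$ (for instance, $\Delta$ is the minimal positive gap). **Algorithm (multi-level SupLinUCB).** For integers $l\ge1$ let (with natural logarithms) $$\iota_1(l)=\log(3LB2^l),\qquad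 \iota_2(l)=\log\frac{d2^l+16\,d\,L^2B^2\,8^l\,\iota_1(l)}{d\,\delta},\qquad \beta(l)=1+R\sqrt{2d\,\iota_2(l)},$$ and let $\lambda=B^{-2}$; none of these depends on $\Delta$ or $\zeta$. Start with empty index sets $\mathcal C^l_0$. In round $k$ set $\mathcal D_k^1=\mathcal D_k$ and, for $l=1,2,\dots$, let $U_k^l=\lambda I+\sum_{i\in\mathcal C_{k-1}^l}x_ix_i^\top$, $\theta_k^l=(U_k^l)^{-1}\sum_{i\in\mathcal C_{k-1}^l}r_ix_i$, $\|x\|_{k,l}=\sqrt{x^\top (U_k^l)^{-1}x}$, $r_k^l(x)=x^\top\theta_k^l+\beta(l)\|x\|_{k,l}$ and $x_k^l\in\arg\max_{x\in\mathcal D_k^l}r_k^l(x)$. (i) If $\max_{x\in\mathcal D_k^l}\|x\|_{k,l}\ge2^{-l}$, choose $x_k\in\arg\max_{x\in\mathcal D_k^l}\|x\|_{k,l}$, add $k$ to the index set of level $l$ only, and end the round. (ii) Otherwise, if $k\le4^ld$, choose $x_k=x_k^l$, leave all index sets unchanged, and end the round. (iii) Otherwise let $\mathcal D_k^{l+1}=\{x\in\mathcal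 D_k^l: r_k^l(x_k^l)-r_k^l(x)\le2\beta(l)2^{-l}\}$ and pass to level $l+1$. **Theorem 2 (Upper Bound for SupLinUCB).** Let $l_\Delta$ be the least positive integer $l$ with $l>\log_2(8\beta(l)/\Delta)$. If $$4\,l_\Delta\,\zeta\left(1+4\sqrt{d\,\iota_1(l_\Delta)}\right)<\Delta,$$ then with probability at least $1-\delta$ $$\mathrm{Regret}(K)\le\frac{2560\,d\,\beta^2(l_\Delta)\,\iota_1(l_\Delta)}{\Delta}.$$ This bound does not depend on $K$, and it is $\tilde O(d^2/\Delta)$: for an absolute constant $c$ it is at most $$c\,(1+R)^2\,\frac{d^2}{\Delta}\left(1+\log\frac{dLB(1+R)}{\delta}+\log\Bigl(1+\frac1\Delta\Bigr)\right)^2 .$$ -/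

import Mathlib

open MeasureTheory ProbabilityTheory
open scoped Matrix

universe u

namespace SupLinUCB

noncomputable section

/-- Arms (contextual vectors): `ℝ^d` with the Euclidean norm. -/
abbrev Arm (d : ℕ) : Type := EuclideanSpace ℝ (Fin d)

/-! ### The parameters of the algorithm -/

/-- `ι₁(l) = log (3 L B 2^l)` (natural logarithm). -/
def iota1 (L B : ℝ) (l : ℕ) : ℝ := Real.log (3 * L * B * 2 ^ l)

/-- `ι₂(l) = log ((2^l + 16 L² B² 8^l ι₁(l)) / δ)` (natural logarithm). -/
def iota2 (L B δ : ℝ) (l : ℕ) : ℝ :=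
  Real.log ((2 ^ l + 16 * L ^ 2 * B ^ 2 * 8 ^ l * iota1 L B l) / δ)

/-- The confidence radius `β(l) = 1 + R √(2 d ι₂(l))`. -/
def radius (d : ℕ) (R L B δ : ℝ) (l : ℕ) : ℝ :=
  1 + R * √(2 * d * iota2 L B δ l)

/-- `l` is the least positive integer with `l > log₂ (8 β(l) / Δ)`. -/
def IsCriticalLevel (β : ℕ → ℝ) (Δ : ℝ) (l : ℕ) : Prop :=
  IsLeast {j : ℕ | 0 < j ∧ Real.logb 2 (8 * β j / Δ) < j} l

/-! ### Ridge regression on a set of rounds -/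

/-- The weighted norm `‖v‖_M = √(vᵀ M v)`. -/
def weightedNorm {d : ℕ} (M : Matrix (Fin d) (Fin d) ℝ) (v : Arm d) : ℝ :=
  √(v.ofLp ⬝ᵥ M *ᵥ v.ofLp)

/-- `U = reg • I + ∑_{i ∈ C} x_i x_iᵀ`. -/
def gram {d : ℕ} (reg : ℝ) (x : ℕ → Arm d) (C : Finset ℕ) : Matrix (Fin d) (Fin d) ℝ :=
  reg • (1 : Matrix (Fin d) (Fin d) ℝ) + ∑ i ∈ C, Matrix.vecMulVec (x i).ofLp (x i).ofLp

/-- The ridge estimator `U⁻¹ ∑_{i ∈ C} y_i x_i`, where `y_i` is the reward of round `i`. -/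
def ridge {d : ℕ} (reg : ℝ) (x : ℕ → Arm d) (y : ℕ → ℝ) (C : Finset ℕ) : Fin d → ℝ :=
  (gram reg x C)⁻¹ *ᵥ ∑ i ∈ C, y i • (x i).ofLp

/-- The uncertainty `‖v‖_{U⁻¹}` of an arm. -/
def uncertainty {d : ℕ} (reg : ℝ) (x : ℕ → Arm d) (C : Finset ℕ) (v : Arm d) : ℝ :=
  weightedNorm (gram reg x C)⁻¹ v

/-- The optimistic reward `vᵀ θ + b ‖v‖_{U⁻¹}`. -/
def ucb {d : ℕ} (reg b : ℝ) (x : ℕ → Arm d) (y : ℕ → ℝ) (C : Finset ℕ) (v : Arm d) : ℝ :=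
  v.ofLp ⬝ᵥ ridge reg x y C + b * uncertainty reg x C v

/-! ### The algorithm -/

/-- One round of multi-level SupLinUCB. `RoundFrom reg β k x y C l A v t` says that the loop of
round `k`, entered at level `l` with the surviving arms `A`, may end with the choice of the arm `v`
and the update `t`: `t = some j` means that `k` is added to the regression set of level `j` (and to
no other one), `t = none` that no regression set changes. Here `C j` is the regression set of level
`j` before round `k`, and `x`, `y` are the arms and rewards of the past rounds. Ties between
maximizers may be broken in any way. -/
inductive RoundFrom {d : ℕ} (reg : ℝ) (β : ℕ → ℝ) (k : ℕ) (x : ℕ → Arm d) (y : ℕ → ℝ)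
    (C : ℕ → Finset ℕ) : ℕ → Set (Arm d) → Arm d → Option ℕ → Prop
  | explore (l : ℕ) (A : Set (Arm d)) (v : Arm d)
      (hv : v ∈ A) (hmax : ∀ w ∈ A, uncertainty reg x (C l) w ≤ uncertainty reg x (C l) v)
      (hlarge : (1 / 2 : ℝ) ^ l ≤ uncertainty reg x (C l) v) :
      RoundFrom reg β k x y C l A v (some l)
  | exploit (l : ℕ) (A : Set (Arm d)) (v : Arm d)
      (hsmall : ∀ w ∈ A, uncertainty reg x (C l) w < (1 / 2 : ℝ) ^ l)
      (hk : k ≤ 4 ^ l * d)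
      (hv : v ∈ A) (hmax : ∀ w ∈ A, ucb reg (β l) x y (C l) w ≤ ucb reg (β l) x y (C l) v) :
      RoundFrom reg β k x y C l A v none
  | eliminate (l : ℕ) (A : Set (Arm d)) (m v : Arm d) (t : Option ℕ)
      (hsmall : ∀ w ∈ A, uncertainty reg x (C l) w < (1 / 2 : ℝ) ^ l)
      (hk : 4 ^ l * d < k)
      (hm : m ∈ A) (hmax : ∀ w ∈ A, ucb reg (β l) x y (C l) w ≤ ucb reg (β l) x y (C l) m)
      (hnext : RoundFrom reg β k x y C (l + 1)
        {w ∈ A | ucb reg (β l) x y (C l) m - ucb reg (β l) x y (C l) w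
          ≤ 2 * β l * (1 / 2 : ℝ) ^ l} v t) :
      RoundFrom reg β k x y C l A v t

/-- The rounds `i ≤ k` (rounds are numbered from 1) that were added to the regression set of
level `l`, where `tag i` is the update made in round `i`. -/
def regressionSet (tag : ℕ → Option ℕ) (k l : ℕ) : Finset ℕ :=
  {i ∈ Finset.Icc 1 k | tag i = some l}

/-- `x`, `tag` are the arms and updates of a run of SupLinUCB for `K` rounds on the decision sets
`D` when the observed rewards are `y`. -/
def IsRun {d : ℕ} (reg : ℝ) (β : ℕ → ℝ) (K : ℕ) (D : ℕ → Set (Arm d)) (x : ℕ → Arm d)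
    (y : ℕ → ℝ) (tag : ℕ → Option ℕ) : Prop :=
  ∀ k ∈ Finset.Icc 1 K,
    RoundFrom reg β k x y (regressionSet tag (k - 1)) 1 (D k) (x k) (tag k)

/-! ### The environment -/

/-- The optimal expected reward `max_{x ∈ A} r(x)` on a decision set. -/
def optReward {d : ℕ} (r : Arm d → ℝ) (A : Set (Arm d)) : ℝ := sSup (r '' A)

/-- The sub-optimality gap of the arm `v` in the decision set `A`. -/
def gap {d : ℕ} (r : Arm d → ℝ) (A : Set (Arm d)) (v : Arm d) : ℝ := optReward r A - r v

/-- The cumulative regret of the first `K` rounds. -/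
def regret {d : ℕ} (r : Arm d → ℝ) (K : ℕ) (D : ℕ → Set (Arm d)) (x : ℕ → Arm d) : ℝ :=
  ∑ k ∈ Finset.Icc 1 K, (optReward r (D k) - r (x k))

/-- Conditionally on `m`, `X` is `R`-sub-Gaussian: `E[exp (t X) | m] ≤ exp (t² R² / 2)` for all
real `t` (this forces the conditional mean to be zero). -/
def CondSubGaussian {Ω : Type u} {mΩ : MeasurableSpace Ω} (m : MeasurableSpace Ω)
    (μ : Measure[mΩ] Ω) (R : ℝ) (X : Ω → ℝ) : Prop :=
  ∀ t : ℝ, Integrable (fun ω => Real.exp (t * X ω)) μ ∧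
    (μ[fun ω => Real.exp (t * X ω) | m]) ≤ᵐ[μ] fun _ => Real.exp (t ^ 2 * R ^ 2 / 2)

/-- The regret bound `2560 d β²(l) ι₁(l) / Δ`. -/
def regretBound (d : ℕ) (R L B δ Δ : ℝ) (l : ℕ) : ℝ :=
  2560 * d * radius d R L B δ l ^ 2 * iota1 L B l / Δ

end

end SupLinUCB

/-! The probabilistic input is self-normalized concentration by the method of mixtures
(`exists_selfNormalized`). For each level and each fixed direction, the exponential of the noise is
a supermartingale. Averaging over a Gaussian prior on directions, with precision `reg`, gives a
closed form in the noise energy and the determinant of the Gram matrix, and Ville's inequality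
controls it for all rounds at once. Level `j` receives failure probability `δ / 2 ^ j`, so that all
levels hold together with probability at least `1 - δ`; the rest of the regret bound is
deterministic.

Each round added to level `l` has uncertainty at least `2 ^ (-l)`, so it multiplies the Gram
determinant by at least `1 + 4 ^ (-l)`. The trace bounds that determinant polynomially, hence level
`l` holds only about `d * 4 ^ l * iota1` rounds, whatever `K` is. Consequently the noise fits into
`radius`. The misspecification bias `ζ * √|C| * ‖v‖` is also bounded uniformly over the levels up to
`lΔ`, because `‖v‖ < 2 ^ (-l)` wherever the estimate is used (`IsRun.abs_estimate_sub_le`).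

Let `z` be that bias bound. Since `4 * z < Δ`, an arm of positive gap has `2 * z` below half its
gap, so the bias is absorbed by a factor two at each level and does not accumulate. By induction
along a round (`RoundFrom.gap_cases`), an optimal arm survives up to level `lΔ`, the surviving gaps
are at most `16 * b * 2 ^ (-l)` with `b = β lΔ`, and beyond `lΔ` only optimal arms remain. Thus
regret is incurred only at levels `j ≤ lΔ`, in about `d * 4 ^ j * iota1` rounds costing order `b * 2
^ (-j)` each. The geometric sum is of order `d * iota1 * b * 2 ^ lΔ`, and minimality of `lΔ` gives
`2 ^ lΔ ≤ 16 * b / Δ`. -/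

namespace SupLinUCB

/-! ### Regularized Gram matrices: quadratic forms and determinants -/

section LinearAlgebra

variable {d : ℕ}

lemma dotProduct_vecMulVec_mulVec (a u v : Fin d → ℝ) :
    u ⬝ᵥ Matrix.vecMulVec a a *ᵥ v = (u ⬝ᵥ a) * (a ⬝ᵥ v) := by
  rw [Matrix.vecMulVec_mulVec]
  simp [mul_comm]

lemma dotProduct_gram_mulVec (reg : ℝ) (x : ℕ → Arm d) (C : Finset ℕ) (u v : Fin d → ℝ) :
    u ⬝ᵥ gram reg x C *ᵥ v
      = reg * (u ⬝ᵥ v) + ∑ i ∈ C, (u ⬝ᵥ (x i).ofLp) * ((x i).ofLp ⬝ᵥ v) := by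
  unfold gram
  rw [Matrix.add_mulVec, dotProduct_add, Matrix.smul_mulVec, Matrix.one_mulVec, dotProduct_smul,
    smul_eq_mul, Matrix.sum_mulVec, dotProduct_sum]
  simp only [dotProduct_vecMulVec_mulVec]

lemma gram_isHermitian (reg : ℝ) (x : ℕ → Arm d) (C : Finset ℕ) : (gram reg x C).IsHermitian := by
  unfold gram Matrix.IsHermitian
  rw [Matrix.conjTranspose_add, Matrix.conjTranspose_smul, Matrix.conjTranspose_sum]
  simp

lemma gram_posDef {reg : ℝ} (hreg : 0 < reg) (x : ℕ → Arm d) (C : Finset ℕ) :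
    (gram reg x C).PosDef := by
  refine Matrix.PosDef.of_dotProduct_mulVec_pos (gram_isHermitian reg x C) fun v hv => ?_
  rw [star_trivial, dotProduct_gram_mulVec]
  have h1 : 0 < v ⬝ᵥ v := by
    have := (Matrix.PosDef.one (n := Fin d) (R := ℝ)).dotProduct_mulVec_pos hv
    simpa using this
  have h2 : 0 ≤ ∑ i ∈ C, (v ⬝ᵥ (x i).ofLp) * ((x i).ofLp ⬝ᵥ v) :=
    Finset.sum_nonneg fun i _ => by rw [dotProduct_comm v]; exact mul_self_nonneg _
  positivity

lemma posDef_det_isUnit {M : Matrix (Fin d) (Fin d) ℝ} (hM : M.PosDef) : IsUnit M.det :=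
  hM.det_pos.ne'.isUnit

lemma dotProduct_mulVec_symm {M : Matrix (Fin d) (Fin d) ℝ} (hM : M.IsHermitian)
    (u v : Fin d → ℝ) : u ⬝ᵥ M *ᵥ v = v ⬝ᵥ M *ᵥ u := by
  have hT : Mᵀ = M := by
    rw [← Matrix.conjTranspose_eq_transpose_of_trivial]; exact hM
  rw [Matrix.dotProduct_mulVec, ← Matrix.mulVec_transpose, hT, dotProduct_comm]

lemma quadForm_add_smul {M : Matrix (Fin d) (Fin d) ℝ} (hM : M.IsHermitian) (u v : Fin d → ℝ)
    (t : ℝ) : (u + t • v) ⬝ᵥ M *ᵥ (u + t • v)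
      = (v ⬝ᵥ M *ᵥ v) * (t * t) + (2 * (u ⬝ᵥ M *ᵥ v)) * t + u ⬝ᵥ M *ᵥ u := by
  simp only [Matrix.mulVec_add, Matrix.mulVec_smul, dotProduct_add, add_dotProduct, dotProduct_smul,
    smul_dotProduct, smul_eq_mul]
  rw [dotProduct_mulVec_symm hM v u]
  ring

/-- Cauchy–Schwarz for a semidefinite form, from the discriminant of the nonnegative quadratic in
`t` given by `u + t • v`. -/
lemma abs_dotProduct_mulVec_le {M : Matrix (Fin d) (Fin d) ℝ} (hM : M.PosSemidef)
    (u v : Fin d → ℝ) :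
    |u ⬝ᵥ M *ᵥ v| ≤ √(u ⬝ᵥ M *ᵥ u) * √(v ⬝ᵥ M *ᵥ v) := by
  have hu : 0 ≤ u ⬝ᵥ M *ᵥ u := by simpa using hM.dotProduct_mulVec_nonneg u
  have h := discrim_le_zero (fun t : ℝ => by
    have := hM.dotProduct_mulVec_nonneg (u + t • v)
    rw [star_trivial, quadForm_add_smul hM.1] at this
    exact this)
  rw [← Real.sqrt_mul hu]
  refine Real.abs_le_sqrt ?_
  unfold discrim at h
  nlinarith

lemma quadForm_inv_eq {M : Matrix (Fin d) (Fin d) ℝ} (hM : M.PosDef) (v : Fin d → ℝ) :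
    (M⁻¹ *ᵥ v) ⬝ᵥ M *ᵥ (M⁻¹ *ᵥ v) = v ⬝ᵥ M⁻¹ *ᵥ v := by
  rw [Matrix.mulVec_mulVec, Matrix.mul_nonsing_inv _ (posDef_det_isUnit hM), Matrix.one_mulVec,
    dotProduct_comm]

lemma quadForm_inv_nonneg {M : Matrix (Fin d) (Fin d) ℝ} (hM : M.PosDef) (v : Fin d → ℝ) :
    0 ≤ v ⬝ᵥ M⁻¹ *ᵥ v := by
  simpa using hM.inv.posSemidef.dotProduct_mulVec_nonneg v

/-- The Gram matrix dominates `reg • 1`. This bounds the ridge bias caused by `θ`. -/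
lemma reg_mul_quadForm_gram_inv_le {reg : ℝ} (hreg : 0 < reg) (x : ℕ → Arm d) (C : Finset ℕ)
    (v : Fin d → ℝ) : reg * (v ⬝ᵥ (gram reg x C)⁻¹ *ᵥ v) ≤ v ⬝ᵥ v := by
  have hU := gram_posDef hreg x C
  set u := (gram reg x C)⁻¹ *ᵥ v with hu
  set q := v ⬝ᵥ u
  have hq : u ⬝ᵥ gram reg x C *ᵥ u = q := quadForm_inv_eq hU v
  rw [dotProduct_gram_mulVec] at hq
  have h2 : 0 ≤ ∑ i ∈ C, (u ⬝ᵥ (x i).ofLp) * ((x i).ofLp ⬝ᵥ u) :=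
    Finset.sum_nonneg fun i _ => by rw [dotProduct_comm u]; exact mul_self_nonneg _
  -- Expanding this square avoids any appeal to operator monotonicity of the inverse.
  have h3 : 0 ≤ (v - reg • u) ⬝ᵥ (v - reg • u) := by
    simpa using dotProduct_star_self_nonneg (v - reg • u)
  have h4 : (v - reg • u) ⬝ᵥ (v - reg • u) = v ⬝ᵥ v - 2 * reg * q + reg * (reg * (u ⬝ᵥ u)) := by
    simp only [sub_dotProduct, dotProduct_sub, smul_dotProduct, dotProduct_smul, smul_eq_mul]
    rw [dotProduct_comm u v]
    ring
  have h5 : reg * (reg * (u ⬝ᵥ u)) ≤ reg * q := by gcongr; linarith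
  nlinarith

/-- With `u = U⁻¹ v`, the left side is `uᵀ (U - reg • 1) u`. It yields `√|C|` instead of `|C|` in
the misspecification bias. -/
lemma sum_sq_le_quadForm_gram_inv {reg : ℝ} (hreg : 0 < reg) (x : ℕ → Arm d) (C : Finset ℕ)
    (v : Fin d → ℝ) :
    ∑ i ∈ C, (v ⬝ᵥ (gram reg x C)⁻¹ *ᵥ (x i).ofLp) ^ 2 ≤ v ⬝ᵥ (gram reg x C)⁻¹ *ᵥ v := by
  have hU := gram_posDef hreg x C
  have h := quadForm_inv_eq hU v
  rw [dotProduct_gram_mulVec] at h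
  rw [← h]
  have h1 : 0 ≤ ((gram reg x C)⁻¹ *ᵥ v) ⬝ᵥ ((gram reg x C)⁻¹ *ᵥ v) := by
    simpa using dotProduct_star_self_nonneg ((gram reg x C)⁻¹ *ᵥ v)
  have h2 : ∀ i, v ⬝ᵥ (gram reg x C)⁻¹ *ᵥ (x i).ofLp = (x i).ofLp ⬝ᵥ ((gram reg x C)⁻¹ *ᵥ v) :=
    fun i => dotProduct_mulVec_symm hU.inv.1 _ _
  have h3 : ∀ i, (v ⬝ᵥ (gram reg x C)⁻¹ *ᵥ (x i).ofLp) ^ 2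
      = ((gram reg x C)⁻¹ *ᵥ v) ⬝ᵥ (x i).ofLp * ((x i).ofLp ⬝ᵥ ((gram reg x C)⁻¹ *ᵥ v)) := by
    intro i
    rw [h2, dotProduct_comm ((gram reg x C)⁻¹ *ᵥ v), sq]
  simp only [h3]
  have : 0 ≤ reg * (((gram reg x C)⁻¹ *ᵥ v) ⬝ᵥ ((gram reg x C)⁻¹ *ᵥ v)) := by positivity
  linarith

lemma det_add_vecMulVec_self {M : Matrix (Fin d) (Fin d) ℝ} (hM : M.PosDef) (v : Fin d → ℝ) :
    (M + Matrix.vecMulVec v v).det = M.det * (1 + v ⬝ᵥ M⁻¹ *ᵥ v) := by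
  rw [Matrix.vecMulVec_eq Unit,
    Matrix.det_add_replicateCol_mul_replicateRow (posDef_det_isUnit hM)]
  congr 1
  rw [Matrix.mul_assoc, Matrix.det_unique]
  simp [Matrix.mul_apply, Matrix.mulVec, dotProduct]

lemma weightedNorm_sq {M : Matrix (Fin d) (Fin d) ℝ} (hM : M.PosDef) (v : Arm d) :
    weightedNorm M⁻¹ v ^ 2 = v.ofLp ⬝ᵥ M⁻¹ *ᵥ v.ofLp :=
  Real.sq_sqrt (quadForm_inv_nonneg hM _)

lemma gram_insert (reg : ℝ) (x : ℕ → Arm d) {C : Finset ℕ} {k : ℕ} (hk : k ∉ C) :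
    gram reg x (insert k C) = gram reg x C + Matrix.vecMulVec (x k).ofLp (x k).ofLp := by
  unfold gram
  rw [Finset.sum_insert hk]
  abel

lemma det_gram_insert {reg : ℝ} (hreg : 0 < reg) (x : ℕ → Arm d) {C : Finset ℕ} {k : ℕ}
    (hk : k ∉ C) :
    (gram reg x (insert k C)).det = (gram reg x C).det * (1 + uncertainty reg x C (x k) ^ 2) := by
  rw [gram_insert reg x hk, det_add_vecMulVec_self (gram_posDef hreg x C), uncertainty,
    weightedNorm_sq (gram_posDef hreg x C)]

lemma det_gram_empty (reg : ℝ) (x : ℕ → Arm d) : (gram reg x ∅).det = reg ^ d := by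
  simp [gram]

/-- AM–GM on the eigenvalues. -/
lemma det_le_trace_div_pow (hd : 0 < d) {M : Matrix (Fin d) (Fin d) ℝ} (hM : M.PosSemidef) :
    M.det ≤ (M.trace / d) ^ d := by
  have hd' : (0 : ℝ) < d := by exact_mod_cast hd
  rw [hM.1.det_eq_prod_eigenvalues, hM.1.trace_eq_sum_eigenvalues]
  simp only [RCLike.ofReal_real_eq_id, id]
  have h := Real.geom_mean_le_arith_mean Finset.univ (fun _ => (1 : ℝ)) hM.1.eigenvalues
    (fun _ _ => zero_le_one) (by simpa using hd) (fun i _ => hM.eigenvalues_nonneg i)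
  simp only [Real.rpow_one, one_mul, Finset.sum_const, Finset.card_univ, Fintype.card_fin,
    nsmul_eq_mul, mul_one] at h
  have hp : 0 ≤ ∏ i, hM.1.eigenvalues i := Finset.prod_nonneg fun i _ => hM.eigenvalues_nonneg i
  calc ∏ i, hM.1.eigenvalues i = ((∏ i, hM.1.eigenvalues i) ^ (d : ℝ)⁻¹) ^ d := by
        rw [← Real.rpow_natCast, ← Real.rpow_mul hp, inv_mul_cancel₀ hd'.ne', Real.rpow_one]
    _ ≤ _ := by gcongr

lemma dotProduct_self_eq_norm_sq (v : Arm d) : v.ofLp ⬝ᵥ v.ofLp = ‖v‖ ^ 2 := by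
  rw [EuclideanSpace.norm_sq_eq]
  simp [dotProduct, sq]

lemma trace_gram (reg : ℝ) (x : ℕ → Arm d) (C : Finset ℕ) :
    (gram reg x C).trace = reg * d + ∑ i ∈ C, ‖x i‖ ^ 2 := by
  simp [gram, Matrix.trace_sum, Matrix.trace_vecMulVec, dotProduct_self_eq_norm_sq]

lemma det_gram_le (hd : 0 < d) {reg L : ℝ} (hreg : 0 < reg) {x : ℕ → Arm d} {C : Finset ℕ}
    (hx : ∀ i ∈ C, ‖x i‖ ≤ L) :
    (gram reg x C).det ≤ reg ^ d * (1 + C.card * L ^ 2 / (reg * d)) ^ d := by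
  have hd' : (0 : ℝ) < d := by exact_mod_cast hd
  refine (det_le_trace_div_pow hd (gram_posDef hreg x C).posSemidef).trans ?_
  rw [trace_gram, ← mul_pow]
  have h1 : ∑ i ∈ C, ‖x i‖ ^ 2 ≤ C.card * L ^ 2 := by
    rw [← nsmul_eq_mul]
    exact Finset.sum_le_card_nsmul _ _ _ fun i hi => by
      have := hx i hi
      gcongr
  have h2 : reg * (1 + C.card * L ^ 2 / (reg * d)) = (reg * d + C.card * L ^ 2) / d := by
    field_simp
  rw [h2]
  have h3 : 0 ≤ ∑ i ∈ C, ‖x i‖ ^ 2 := Finset.sum_nonneg fun i _ => by positivity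
  gcongr

/-- Elliptic potential argument: by the rank-one determinant formula, each selected round multiplies
the determinant by `1 + uncertainty ^ 2`, which is at least `1 + a ^ 2`. -/
lemma pow_card_le_det_gram {reg a : ℝ} (hreg : 0 < reg) (ha : 0 ≤ a) (x : ℕ → Arm d)
    (p : ℕ → Prop) [DecidablePred p] (n : ℕ)
    (h : ∀ k ∈ Finset.Icc 1 n, p k →
      a ≤ uncertainty reg x ((Finset.Icc 1 (k - 1)).filter p) (x k)) :
    reg ^ d * (1 + a ^ 2) ^ ((Finset.Icc 1 n).filter p).card
      ≤ (gram reg x ((Finset.Icc 1 n).filter p)).det := by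
  induction n with
  | zero => simp [det_gram_empty]
  | succ n ih =>
    have ih' := ih fun k hk => h k (Finset.Icc_subset_Icc le_rfl n.le_succ hk)
    rw [← Finset.insert_Icc_right_eq_Icc_add_one (by omega), Finset.filter_insert]
    split_ifs with hp
    · have hn : n + 1 ∉ (Finset.Icc 1 n).filter p := by simp
      rw [Finset.card_insert_of_notMem hn, det_gram_insert hreg x hn, pow_succ, ← mul_assoc]
      have := h (n + 1) (by simp) hp
      simp only [Nat.add_sub_cancel] at this
      have := (gram_posDef hreg x ((Finset.Icc 1 n).filter p)).det_pos
      gcongr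
    · exact ih'

end LinearAlgebra

/-! ### Size and monotonicity of the parameters -/

section Parameters

lemma one_le_mul_of_one_le {L B : ℝ} (hL : 1 ≤ L) (hB : 1 ≤ B) : 1 ≤ L * B := by nlinarith

lemma one_le_log_three : (1 : ℝ) ≤ Real.log 3 := by
  rw [Real.le_log_iff_exp_le (by norm_num)]
  linarith [Real.exp_one_lt_d9]

lemma one_le_iota1 {L B : ℝ} (hL : 1 ≤ L) (hB : 1 ≤ B) (l : ℕ) : 1 ≤ iota1 L B l := by
  refine one_le_log_three.trans (Real.log_le_log (by norm_num) ?_)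
  have h1 := one_le_mul_of_one_le hL hB
  have h2 : (1 : ℝ) ≤ 2 ^ l := one_le_pow₀ (by norm_num)
  nlinarith

lemma iota1_mono {L B : ℝ} (hL : 1 ≤ L) (hB : 1 ≤ B) : Monotone (iota1 L B) := by
  intro i j hij
  refine Real.log_le_log (by positivity) ?_
  have : (2 : ℝ) ^ i ≤ 2 ^ j := pow_le_pow_right₀ (by norm_num) hij
  gcongr

lemma iota2_mono {L B δ : ℝ} (hL : 1 ≤ L) (hB : 1 ≤ B) (hδ : 0 < δ) : Monotone (iota2 L B δ) := by
  intro i j hij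
  have hi := one_le_iota1 hL hB i
  have h1 : (2 : ℝ) ^ i ≤ 2 ^ j := pow_le_pow_right₀ (by norm_num) hij
  have h2 : (8 : ℝ) ^ i ≤ 8 ^ j := pow_le_pow_right₀ (by norm_num) hij
  have h3 := iota1_mono hL hB hij
  refine Real.log_le_log (by positivity) ?_
  gcongr

lemma one_le_radius {d : ℕ} {R L B δ : ℝ} (hR : 0 ≤ R) (l : ℕ) : 1 ≤ radius d R L B δ l :=
  le_add_of_nonneg_right (by positivity)

lemma radius_mono {d : ℕ} {R L B δ : ℝ} (hR : 0 ≤ R) (hL : 1 ≤ L) (hB : 1 ≤ B) (hδ : 0 < δ) :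
    Monotone (radius d R L B δ) := by
  intro i j hij
  unfold radius
  have := iota2_mono hL hB hδ hij
  gcongr

lemma two_mul_iota1 (L B : ℝ) (l : ℕ) :
    2 * iota1 L B l = Real.log (9 * 4 ^ l * (L * B) ^ 2) := by
  have h := Real.log_pow (3 * L * B * 2 ^ l) 2
  unfold iota1
  push_cast at h
  rw [← h]
  congr 1
  have : (4 : ℝ) ^ l = (2 ^ l) ^ 2 := by rw [← pow_mul, mul_comm, pow_mul]; norm_num
  rw [this]
  ring

/-- Solves the implicit inequality between the two determinant bounds: the logarithm on the right is
replaced by a tangent line whose slope is small against `4 ^ (-l)`. -/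
lemma card_le_of_mul_log_le {d L B n : ℝ} {l : ℕ} (hd : 0 < d) (hL : 1 ≤ L) (hB : 1 ≤ B)
    (hn : 0 ≤ n)
    (h : n * Real.log (1 + (1 / 4) ^ l) ≤ d * Real.log (1 + n * (L * B) ^ 2 / d)) (hl : 1 ≤ l) :
    n ≤ 3 * d * 4 ^ l * iota1 L B l := by
  have hLB := one_le_mul_of_one_le hL hB
  set A : ℝ := 4 ^ l with hA
  set M : ℝ := (L * B) ^ 2 with hM
  have hM1 : 1 ≤ M := one_le_pow₀ hLB
  have hA4 : 4 ≤ A := by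
    calc (4 : ℝ) = 4 ^ 1 := by norm_num
      _ ≤ 4 ^ l := pow_le_pow_right₀ (by norm_num) hl
  have hι := two_mul_iota1 L B l
  rw [← hA, ← hM] at hι
  have hw : 0 < 9 * A * M := by positivity
  -- Tangent to the logarithm at `9 * A * M = (3 L B 2 ^ l) ^ 2`, whose logarithm is `2 * iota1`.
  have h1 : Real.log (1 + n * M / d) ≤ (1 + n * M / d) / (9 * A * M) - 1 + 2 * iota1 L B l := by
    have := Real.log_le_sub_one_of_pos (x := (1 + n * M / d) / (9 * A * M)) (by positivity)
    rw [Real.log_div (by positivity) hw.ne'] at this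
    linarith
  -- Uses `log (1 + 1 / A) ≥ 1 / (A + 1)` and `A ≥ 4`, which is where `1 ≤ l` enters.
  have h2 : 4 / 5 / A ≤ Real.log (1 + (1 / 4) ^ l) := by
    have h3 : (1 / 4 : ℝ) ^ l = 1 / A := by rw [hA, one_div_pow]
    rw [h3]
    refine le_trans ?_ (Real.one_sub_inv_le_log_of_pos (by positivity))
    have : 1 - (1 + 1 / A)⁻¹ = 1 / (A + 1) := by field_simp; ring
    rw [this, div_div, div_le_div_iff₀ (by positivity) (by positivity)]
    linarith
  have h4 : n * (4 / 5 / A) ≤ d * ((1 + n * M / d) / (9 * A * M) - 1 + 2 * iota1 L B l) :=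
    (mul_le_mul_of_nonneg_left h2 hn).trans (h.trans (mul_le_mul_of_nonneg_left h1 hd.le))
  have h5 : d * ((1 + n * M / d) / (9 * A * M)) ≤ d + n / (9 * A) := by
    have : d * ((1 + n * M / d) / (9 * A * M)) = d / (9 * A * M) + n / (9 * A) := by
      field_simp
    rw [this]
    have : d / (9 * A * M) ≤ d := div_le_self hd.le (by nlinarith)
    linarith
  have h6 : n * (4 / 5 / A) = 4 / 5 * (n / A) := by ring
  -- The tangent's `-d` cancels the `d` of `h5`, leaving `(4/5 - 1/9) * (n / A) ≤ 2 * d * iota1`,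
  -- and `2 / (4/5 - 1/9) = 90/31 < 3`.
  have h7 : n / (9 * A) = 1 / 9 * (n / A) := by field_simp
  have h8 : n / A ≤ 3 * d * iota1 L B l := by
    have : 0 ≤ d * iota1 L B l := by
      have := one_le_iota1 hL hB l
      positivity
    nlinarith
  rw [div_le_iff₀ (by positivity)] at h8
  linarith

end Parameters

/-! ### Conditionally sub-Gaussian noise with a predictable multiplier -/

section Noise

variable {Ω : Type u} {m mΩ : MeasurableSpace Ω} {μ : Measure Ω}

lemma CondSubGaussian.setLIntegral_exp_le [IsFiniteMeasure μ] {R : ℝ} {X : Ω → ℝ} (hm : m ≤ mΩ)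
    (hX : CondSubGaussian m μ R X) (t : ℝ) {A : Set Ω} (hA : MeasurableSet[m] A) :
    ∫⁻ ω in A, ENNReal.ofReal (Real.exp (t * X ω)) ∂μ
      ≤ ENNReal.ofReal (Real.exp (t ^ 2 * R ^ 2 / 2)) * μ A := by
  obtain ⟨hint, hle⟩ := hX t
  rw [← ofReal_integral_eq_lintegral_ofReal hint.integrableOn
    (Filter.Eventually.of_forall fun _ => (Real.exp_pos _).le), ← setIntegral_condExp hm hint hA]
  have h1 : ∫ ω in A, (μ[fun ω => Real.exp (t * X ω) | m]) ω ∂μ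
      ≤ ∫ _ in A, Real.exp (t ^ 2 * R ^ 2 / 2) ∂μ :=
    integral_mono_ae integrable_condExp.integrableOn (integrable_const _) (ae_restrict_of_ae hle)
  refine (ENNReal.ofReal_le_ofReal h1).trans_eq ?_
  rw [setIntegral_const, smul_eq_mul, mul_comm, ENNReal.ofReal_mul (Real.exp_pos _).le,
    ofReal_measureReal]

/-- Restricted to `m`, the measure with density `exp (t X - t ^ 2 / 2)` lies below `μ`; integrating
the `m`-measurable `g` against both gives the claim with no integrability condition on `g`. -/
lemma CondSubGaussian.lintegral_mul_exp_const_le [IsFiniteMeasure μ] {X : Ω → ℝ} (hm : m ≤ mΩ)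
    (hXm : Measurable X) (hX : CondSubGaussian m μ 1 X) (t : ℝ) {g : Ω → ENNReal}
    (hg : Measurable[m] g) :
    ∫⁻ ω, g ω * ENNReal.ofReal (Real.exp (t * X ω - t ^ 2 / 2)) ∂μ ≤ ∫⁻ ω, g ω ∂μ := by
  set f : Ω → ENNReal := fun ω => ENNReal.ofReal (Real.exp (t * X ω - t ^ 2 / 2)) with hf
  have hfm : Measurable f := by fun_prop
  have h1 : (μ.withDensity f).trim hm ≤ μ.trim hm := by
    refine Measure.le_iff.2 fun A hA => ?_
    rw [trim_measurableSet_eq hm hA, trim_measurableSet_eq hm hA, withDensity_apply _ (hm A hA)]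
    have h2 := hX.setLIntegral_exp_le hm t hA
    have h3 : ∀ ω, f ω = ENNReal.ofReal (Real.exp (-(t ^ 2 / 2)))
        * ENNReal.ofReal (Real.exp (t * X ω)) := fun ω => by
      rw [← ENNReal.ofReal_mul (Real.exp_pos _).le, ← Real.exp_add, hf]
      ring_nf
    simp only [h3]
    rw [lintegral_const_mul _ (by fun_prop)]
    refine (mul_le_mul_right h2 _).trans_eq ?_
    rw [← mul_assoc, ← ENNReal.ofReal_mul (Real.exp_pos _).le, ← Real.exp_add]
    ring_nf
    simp
  have h2 : ∫⁻ ω, g ω * f ω ∂μ = ∫⁻ ω, g ω ∂(μ.withDensity f) := by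
    rw [lintegral_withDensity_eq_lintegral_mul μ hfm (hg.mono hm le_rfl)]
    simp [mul_comm]
  rw [h2, ← lintegral_trim hm hg, ← lintegral_trim hm hg]
  exact lintegral_mono' h1 le_rfl

lemma exists_finite_range_tendsto {Ω : Type u} {m : MeasurableSpace Ω} {T : Ω → ℝ}
    (hT : Measurable T) :
    ∃ S : ℕ → Ω → ℝ, (∀ n, Measurable (S n)) ∧ (∀ n, (Set.range (S n)).Finite) ∧
      ∀ ω, Filter.Tendsto (fun n => S n ω) Filter.atTop (nhds (T ω)) :=
  ⟨fun n => hT.stronglyMeasurable.approx n, fun _ => SimpleFunc.measurable _,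
    fun _ => SimpleFunc.finite_range _, fun ω => hT.stronglyMeasurable.tendsto_approx ω⟩

/-- The event `T = t` belongs to `m`, so `g` can be cut along the level sets of `T` and each piece
handled with a constant multiplier. -/
lemma CondSubGaussian.lintegral_mul_exp_le_of_finite_range [IsFiniteMeasure μ] {X : Ω → ℝ}
    (hm : m ≤ mΩ) (hXm : Measurable X) (hX : CondSubGaussian m μ 1 X) {T : Ω → ℝ}
    (hT : Measurable[m] T) (hfin : (Set.range T).Finite) {g : Ω → ENNReal}
    (hg : Measurable[m] g) :
    ∫⁻ ω, g ω * ENNReal.ofReal (Real.exp (T ω * X ω - T ω ^ 2 / 2)) ∂μ ≤ ∫⁻ ω, g ω ∂μ := by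
  have hgt : ∀ t, Measurable[m] ((T ⁻¹' {t}).indicator g) :=
    fun t => hg.indicator (hT (measurableSet_singleton t))
  have hsplit : ∀ (ω : Ω) (c : ℝ → ENNReal),
      g ω * c (T ω) = ∑ t ∈ hfin.toFinset, (T ⁻¹' {t}).indicator g ω * c t := by
    intro ω c
    rw [Finset.sum_eq_single (T ω)]
    · rw [Set.indicator_of_mem (by simp)]
    · intro t _ ht
      rw [Set.indicator_of_notMem (by simpa using ht.symm), zero_mul]
    · intro h
      exact absurd (by simp) h
  calc ∫⁻ ω, g ω * ENNReal.ofReal (Real.exp (T ω * X ω - T ω ^ 2 / 2)) ∂μ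
      = ∫⁻ ω, ∑ t ∈ hfin.toFinset, (T ⁻¹' {t}).indicator g ω
          * ENNReal.ofReal (Real.exp (t * X ω - t ^ 2 / 2)) ∂μ :=
        lintegral_congr fun ω =>
          hsplit ω fun t => ENNReal.ofReal (Real.exp (t * X ω - t ^ 2 / 2))
    _ = ∑ t ∈ hfin.toFinset, ∫⁻ ω, (T ⁻¹' {t}).indicator g ω
          * ENNReal.ofReal (Real.exp (t * X ω - t ^ 2 / 2)) ∂μ :=
        lintegral_finsetSum _ fun t _ => ((hgt t).mono hm le_rfl).mul (by fun_prop)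
    _ ≤ ∑ t ∈ hfin.toFinset, ∫⁻ ω, (T ⁻¹' {t}).indicator g ω ∂μ :=
        Finset.sum_le_sum fun t _ => hX.lintegral_mul_exp_const_le hm hXm t (hgt t)
    _ = ∫⁻ ω, ∑ t ∈ hfin.toFinset, (T ⁻¹' {t}).indicator g ω ∂μ :=
        (lintegral_finsetSum _ fun t _ => (hgt t).mono hm le_rfl).symm
    _ = ∫⁻ ω, g ω ∂μ := lintegral_congr fun ω => by
        have := hsplit ω 1
        simpa using this.symm

/-- Approximation of `T` by simple functions and Fatou's lemma. -/
lemma CondSubGaussian.lintegral_mul_exp_le [IsFiniteMeasure μ] {X : Ω → ℝ} (hm : m ≤ mΩ)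
    (hXm : Measurable X) (hX : CondSubGaussian m μ 1 X) {T : Ω → ℝ} (hT : Measurable[m] T)
    {g : Ω → ENNReal} (hg : Measurable[m] g) :
    ∫⁻ ω, g ω * ENNReal.ofReal (Real.exp (T ω * X ω - T ω ^ 2 / 2)) ∂μ ≤ ∫⁻ ω, g ω ∂μ := by
  obtain ⟨S, hS, hfin, hlim⟩ := exists_finite_range_tendsto hT
  have hmeas : ∀ n, Measurable (S n) := fun n => (hS n).mono hm le_rfl
  have hgm : Measurable g := hg.mono hm le_rfl
  have h1 : ∀ ω, g ω * ENNReal.ofReal (Real.exp (T ω * X ω - T ω ^ 2 / 2))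
      ≤ Filter.liminf (fun n => g ω * ENNReal.ofReal
          (Real.exp (S n ω * X ω - S n ω ^ 2 / 2))) Filter.atTop := by
    intro ω
    have h2 : Filter.Tendsto (fun n => ENNReal.ofReal
        (Real.exp (S n ω * X ω - S n ω ^ 2 / 2))) Filter.atTop
        (nhds (ENNReal.ofReal (Real.exp (T ω * X ω - T ω ^ 2 / 2)))) :=
      ENNReal.tendsto_ofReal
        ((((hlim ω).mul_const _).sub (((hlim ω).pow 2).div_const 2)).rexp)
    refine (ENNReal.Tendsto.const_mul h2 (Or.inl ?_)).liminf_eq.ge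
    simpa using Real.exp_pos _
  refine (lintegral_mono h1).trans ((lintegral_liminf_le fun n => ?_).trans ?_)
  · have := hmeas n
    fun_prop
  · refine Filter.liminf_le_of_le (by isBoundedDefault) fun b hb => ?_
    obtain ⟨n, hn⟩ := hb.exists
    exact hn.trans (hX.lintegral_mul_exp_le_of_finite_range hm hXm (hS n) (hfin n) hg)

lemma CondSubGaussian.const_mul {R : ℝ} {X : Ω → ℝ} (hX : CondSubGaussian m μ R X) (a : ℝ) :
    CondSubGaussian m μ (a * R) (fun ω => a * X ω) := by
  intro t
  have h := hX (t * a)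
  have h1 : ∀ ω, t * (a * X ω) = t * a * X ω := fun ω => by ring
  have h2 : t ^ 2 * (a * R) ^ 2 / 2 = (t * a) ^ 2 * R ^ 2 / 2 := by ring
  simpa only [h1, h2] using h

/-- Here `exp X + exp (-X) - 2` is nonnegative with integral at most zero, and vanishes only where
`X = 0`. This covers `R = 0`, where the noise cannot be rescaled. -/
lemma CondSubGaussian.ae_eq_zero [IsFiniteMeasure μ] {X : Ω → ℝ} (hm : m ≤ mΩ)
    (hX : CondSubGaussian m μ 0 X) : ∀ᵐ ω ∂μ, X ω = 0 := by
  have hle : ∀ t : ℝ, ∫ ω, Real.exp (t * X ω) ∂μ ≤ μ.real Set.univ := fun t => by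
    obtain ⟨_, h⟩ := hX t
    rw [← integral_condExp hm]
    refine (integral_mono_ae integrable_condExp (integrable_const _) h).trans_eq ?_
    simp
  have hp := (hX 1).1
  have hn := (hX (-1)).1
  have hnonneg : ∀ ω, 0 ≤ Real.exp (1 * X ω) + Real.exp (-1 * X ω) - 2 := fun ω => by
    have h1 := Real.add_one_le_exp (1 * X ω)
    have h2 := Real.add_one_le_exp (-1 * X ω)
    linarith
  have hint : ∫ ω, (Real.exp (1 * X ω) + Real.exp (-1 * X ω) - 2) ∂μ = 0 := by
    refine le_antisymm ?_ (integral_nonneg hnonneg)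
    rw [integral_sub (f := fun ω => Real.exp (1 * X ω) + Real.exp (-1 * X ω)) (hp.add hn)
      (integrable_const _), integral_add hp hn]
    have h1 := hle 1
    have h2 := hle (-1)
    simp only [integral_const, smul_eq_mul]
    linarith
  rw [integral_eq_zero_iff_of_nonneg hnonneg ((hp.add hn).sub (integrable_const _))] at hint
  filter_upwards [hint] with ω hω
  by_contra hne
  have h1 := Real.add_one_lt_exp (x := 1 * X ω) (by simpa using hne)
  have h2 := Real.add_one_le_exp (-1 * X ω)
  simp only [Pi.zero_apply] at hω
  linarith

end Noise

/-! ### Ville's maximal inequality -/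

section Ville

variable {Ω : Type u} {mΩ : MeasurableSpace Ω} {μ : Measure Ω}

/-- Ville's maximal inequality for a nonnegative supermartingale on finitely many rounds. -/
lemma mul_measure_exists_le_lintegral (𝓕 : Filtration ℕ mΩ) (F : ℕ → Ω → ENNReal) (K : ℕ)
    (hF : ∀ k ≤ K, Measurable[𝓕 k] (F k))
    (hsuper : ∀ k < K, ∀ A, MeasurableSet[𝓕 k] A → ∫⁻ ω in A, F (k + 1) ω ∂μ ≤ ∫⁻ ω in A, F k ω ∂μ)
    (c : ENNReal) : c * μ {ω | ∃ k ≤ K, c ≤ F k ω} ≤ ∫⁻ ω, F 0 ω ∂μ := by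
  -- The process is stopped once it reaches `c`: paths already stopped count for at least `c` each,
  -- the others still carry `F n`.
  have key : ∀ n ≤ K, MeasurableSet[𝓕 n] {ω | ∃ k ≤ n, c ≤ F k ω} ∧
      c * μ {ω | ∃ k ≤ n, c ≤ F k ω} + ∫⁻ ω in {ω | ∃ k ≤ n, c ≤ F k ω}ᶜ, F n ω ∂μ
        ≤ ∫⁻ ω, F 0 ω ∂μ := by
    intro n
    induction n with
    | zero =>
      intro _
      have hm : MeasurableSet[𝓕 0] {ω | c ≤ F 0 ω} := measurableSet_le measurable_const (hF 0 bot_le)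
      simp only [Nat.le_zero_eq, exists_eq_left]
      refine ⟨hm, ?_⟩
      rw [← lintegral_add_compl (μ := μ) (F 0) (𝓕.le 0 _ hm)]
      refine add_le_add ?_ le_rfl
      rw [← setLIntegral_const]
      exact setLIntegral_mono ((hF 0 bot_le).mono (𝓕.le 0) le_rfl) fun ω hω => hω
    | succ n ih =>
      intro hn
      obtain ⟨hB, hle⟩ := ih (by omega)
      set B := {ω | ∃ k ≤ n, c ≤ F k ω} with hBdef
      set E := {ω | c ≤ F (n + 1) ω} with hEdef
      have hFm : Measurable (F (n + 1)) := (hF _ hn).mono (𝓕.le _) le_rfl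
      have hEm : MeasurableSet[𝓕 (n + 1)] E := measurableSet_le measurable_const (hF _ hn)
      have hBm : MeasurableSet[𝓕 (n + 1)] B := 𝓕.mono n.le_succ _ hB
      have hunion : {ω | ∃ k ≤ n + 1, c ≤ F k ω} = B ∪ (Bᶜ ∩ E) := by
        ext ω
        simp only [hBdef, hEdef, Set.mem_ofPred_eq, Set.mem_union, Set.mem_inter_iff,
          Set.mem_compl_iff]
        constructor
        · rintro ⟨k, hk, h⟩
          by_cases hω : ∃ k ≤ n, c ≤ F k ω
          · exact Or.inl hω
          · rcases Nat.lt_or_eq_of_le hk with hk | rfl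
            · exact Or.inl ⟨k, by omega, h⟩
            · exact Or.inr ⟨hω, h⟩
        · rintro (⟨k, hk, h⟩ | ⟨_, h⟩)
          · exact ⟨k, by omega, h⟩
          · exact ⟨n + 1, le_rfl, h⟩
      have hcompl : (B ∪ (Bᶜ ∩ E))ᶜ = Bᶜ \ E := by
        ext ω
        simp only [Set.mem_compl_iff, Set.mem_union, Set.mem_inter_iff, Set.mem_sdiff]
        tauto
      rw [hunion, hcompl]
      refine ⟨hBm.union (hBm.compl.inter hEm), le_trans ?_ hle⟩
      have h1 : μ (B ∪ (Bᶜ ∩ E)) ≤ μ B + μ (Bᶜ ∩ E) := measure_union_le _ _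
      have h2 : ∫⁻ ω in Bᶜ, F (n + 1) ω ∂μ
          = ∫⁻ ω in Bᶜ ∩ E, F (n + 1) ω ∂μ + ∫⁻ ω in Bᶜ \ E, F (n + 1) ω ∂μ :=
        (lintegral_inter_add_sdiff _ _ (𝓕.le _ _ hEm)).symm
      have h3 : c * μ (Bᶜ ∩ E) ≤ ∫⁻ ω in Bᶜ ∩ E, F (n + 1) ω ∂μ := by
        rw [← setLIntegral_const]
        exact setLIntegral_mono hFm fun ω hω => hω.2
      have h4 := hsuper n (by omega) Bᶜ hB.compl
      calc c * μ (B ∪ (Bᶜ ∩ E)) + ∫⁻ ω in Bᶜ \ E, F (n + 1) ω ∂μ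
          ≤ c * (μ B + μ (Bᶜ ∩ E)) + ∫⁻ ω in Bᶜ \ E, F (n + 1) ω ∂μ := by gcongr
        _ = c * μ B + (c * μ (Bᶜ ∩ E) + ∫⁻ ω in Bᶜ \ E, F (n + 1) ω ∂μ) := by ring
        _ ≤ c * μ B + (∫⁻ ω in Bᶜ ∩ E, F (n + 1) ω ∂μ + ∫⁻ ω in Bᶜ \ E, F (n + 1) ω ∂μ) := by
          gcongr
        _ = c * μ B + ∫⁻ ω in Bᶜ, F (n + 1) ω ∂μ := by rw [h2]
        _ ≤ _ := by gcongr
  exact le_trans le_self_add (key K le_rfl).2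

end Ville

/-! ### Gaussian integrals -/

section GaussianIntegral

variable {d : ℕ}

/-- The Gaussian integral `∫ exp (-½ uᵀ M u) du`. -/
noncomputable def gaussianLIntegral (M : Matrix (Fin d) (Fin d) ℝ) : ENNReal :=
  ∫⁻ u : Fin d → ℝ, ENNReal.ofReal (Real.exp (-(u ⬝ᵥ M *ᵥ u) / 2))

lemma measurable_quadForm (M : Matrix (Fin d) (Fin d) ℝ) :
    Measurable fun u : Fin d → ℝ => u ⬝ᵥ M *ᵥ u := by
  simp only [dotProduct, Matrix.mulVec]
  fun_prop

lemma gaussianLIntegral_one_ne_top : gaussianLIntegral (1 : Matrix (Fin d) (Fin d) ℝ) ≠ ⊤ := by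
  have h : Integrable fun u : Fin d → ℝ => ∏ i, Real.exp (-(1 / 2) * u i ^ 2) :=
    Integrable.fintype_prod (f := fun (_ : Fin d) (s : ℝ) => Real.exp (-(1 / 2) * s ^ 2))
      fun _ => integrable_exp_neg_mul_sq (by norm_num)
  have h2 : ∀ u : Fin d → ℝ, Real.exp (-(u ⬝ᵥ (1 : Matrix (Fin d) (Fin d) ℝ) *ᵥ u) / 2)
      = ∏ i, Real.exp (-(1 / 2) * u i ^ 2) := fun u => by
    rw [← Real.exp_sum, Matrix.one_mulVec, ← Finset.mul_sum]
    congr 1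
    simp only [dotProduct, sq]
    ring
  unfold gaussianLIntegral
  simp only [h2]
  exact h.lintegral_lt_top.ne

lemma gaussianLIntegral_ne_zero (M : Matrix (Fin d) (Fin d) ℝ) : gaussianLIntegral M ≠ 0 := by
  have hm := measurable_quadForm M
  unfold gaussianLIntegral
  rw [Ne, lintegral_eq_zero_iff (by fun_prop)]
  intro h
  have h2 : ∀ᵐ u : Fin d → ℝ, False := by
    filter_upwards [h] with u hu
    simp only [Pi.zero_apply, ENNReal.ofReal_eq_zero] at hu
    exact absurd hu (not_le.2 (Real.exp_pos _))
  rw [Filter.eventually_false_iff_eq_bot, ae_eq_bot] at h2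
  exact NeZero.ne _ h2

/-- Factor `M = Aᵀ A` and substitute `A u`; the Jacobian is `|det A| = √(det M)`. The integral for
the identity stays unevaluated, since only ratios matter later. -/
lemma gaussianLIntegral_eq {M : Matrix (Fin d) (Fin d) ℝ} (hM : M.PosDef) :
    gaussianLIntegral M
      = ENNReal.ofReal (√M.det)⁻¹ * gaussianLIntegral (1 : Matrix (Fin d) (Fin d) ℝ) := by
  obtain ⟨A, hA⟩ : ∃ A : Matrix (Fin d) (Fin d) ℝ, M = Aᵀ * A := by
    open scoped MatrixOrder in
    have h0 : 0 ≤ M := Matrix.nonneg_iff_posSemidef.2 hM.posSemidef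
    obtain ⟨A, hA⟩ := CStarAlgebra.nonneg_iff_eq_star_mul_self.1 h0
    exact ⟨A, by rw [hA, Matrix.star_eq_conjTranspose, Matrix.conjTranspose_eq_transpose_of_trivial]⟩
  have hdet : M.det = A.det ^ 2 := by rw [hA, Matrix.det_mul, Matrix.det_transpose, sq]
  have hAdet : A.det ≠ 0 := fun h => hM.det_pos.ne' (by rw [hdet, h]; ring)
  have hlin : LinearMap.det (Matrix.toLin' A) ≠ 0 := by rwa [LinearMap.det_toLin']
  have hmap := Measure.map_linearMap_addHaar_eq_smul_addHaar
    (volume : Measure (Fin d → ℝ)) hlin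
  have hm := measurable_quadForm (1 : Matrix (Fin d) (Fin d) ℝ)
  have hlm : Measurable (Matrix.toLin' A) :=
    (LinearMap.continuous_of_finiteDimensional (Matrix.toLin' A)).measurable
  have h1 : ∀ u : Fin d → ℝ, u ⬝ᵥ M *ᵥ u
      = (Matrix.toLin' A u) ⬝ᵥ (1 : Matrix (Fin d) (Fin d) ℝ) *ᵥ (Matrix.toLin' A u) := fun u => by
    rw [hA, Matrix.one_mulVec, Matrix.toLin'_apply, ← Matrix.mulVec_mulVec,
      Matrix.dotProduct_mulVec, Matrix.vecMul_transpose]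
  unfold gaussianLIntegral
  simp only [h1]
  rw [← lintegral_map (f := fun v : Fin d → ℝ => ENNReal.ofReal (Real.exp
    (-(v ⬝ᵥ (1 : Matrix (Fin d) (Fin d) ℝ) *ᵥ v) / 2))) (by fun_prop) hlm, hmap,
    lintegral_smul_measure, LinearMap.det_toLin', hdet, Real.sqrt_sq_eq_abs, abs_inv, smul_eq_mul]

/-- Completing the square: translate by `M⁻¹ s`. -/
lemma lintegral_exp_dotProduct_sub_quadForm {M : Matrix (Fin d) (Fin d) ℝ} (hM : M.PosDef)
    (s : Fin d → ℝ) :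
    ∫⁻ u : Fin d → ℝ, ENNReal.ofReal (Real.exp (u ⬝ᵥ s - (u ⬝ᵥ M *ᵥ u) / 2))
      = ENNReal.ofReal (Real.exp ((s ⬝ᵥ M⁻¹ *ᵥ s) / 2)) * gaussianLIntegral M := by
  have hm := measurable_quadForm M
  unfold gaussianLIntegral
  rw [← lintegral_const_mul _ (by fun_prop),
    ← lintegral_add_right_eq_self _ (M⁻¹ *ᵥ s)]
  refine lintegral_congr fun u => ?_
  rw [← ENNReal.ofReal_mul (Real.exp_pos _).le, ← Real.exp_add]
  congr 2
  have h1 := quadForm_add_smul hM.1 u (M⁻¹ *ᵥ s) 1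
  have h2 := quadForm_inv_eq hM s
  have h3 : M *ᵥ (M⁻¹ *ᵥ s) = s := by
    rw [Matrix.mulVec_mulVec, Matrix.mul_nonsing_inv _ (posDef_det_isUnit hM), Matrix.one_mulVec]
  rw [one_smul, h2, h3] at h1
  rw [h1, add_dotProduct, dotProduct_comm (M⁻¹ *ᵥ s) s]
  ring

end GaussianIntegral

/-! ### Self-normalized concentration by the method of mixtures -/

section SelfNormalized

variable {d : ℕ} {Ω : Type u}

/-- The squared norm `‖∑ ε_i x_i‖²` in `U⁻¹`, where `U` is the regularized Gram matrix. -/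
noncomputable def noiseEnergy (reg : ℝ) (x : ℕ → Arm d) (ε : ℕ → ℝ) (C : Finset ℕ) : ℝ :=
  (∑ i ∈ C, ε i • (x i).ofLp) ⬝ᵥ (gram reg x C)⁻¹ *ᵥ ∑ i ∈ C, ε i • (x i).ofLp

lemma noiseEnergy_const_mul (reg : ℝ) (x : ℕ → Arm d) (ε : ℕ → ℝ) (C : Finset ℕ) (a : ℝ) :
    noiseEnergy reg x (fun i => a * ε i) C = a ^ 2 * noiseEnergy reg x ε C := by
  unfold noiseEnergy
  simp only [mul_smul]
  rw [← Finset.smul_sum, Matrix.mulVec_smul, dotProduct_smul, smul_dotProduct, smul_eq_mul,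
    smul_eq_mul]
  ring

/-- The component of the arm of round `k` in direction `v` if the round belongs to level `l`. -/
noncomputable def score (x : ℕ → Ω → Arm d) (tag : ℕ → Ω → Option ℕ) (l k : ℕ) (v : Fin d → ℝ)
    (ω : Ω) : ℝ :=
  if tag k ω = some l then v ⬝ᵥ (x k ω).ofLp else 0

/-- The exponential supermartingale of level `l` in direction `v`. -/
noncomputable def expMart (x : ℕ → Ω → Arm d) (tag : ℕ → Ω → Option ℕ) (ε : ℕ → Ω → ℝ) (l k : ℕ)
    (v : Fin d → ℝ) (ω : Ω) : ENNReal :=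
  ENNReal.ofReal (Real.exp (∑ i ∈ Finset.Icc 1 k,
    (score x tag l i v ω * ε i ω - score x tag l i v ω ^ 2 / 2)))

/-- The mixture of the exponential supermartingales over a finite measure on the directions. -/
noncomputable def mixMart (ρ : Measure (Fin d → ℝ)) (x : ℕ → Ω → Arm d) (tag : ℕ → Ω → Option ℕ)
    (ε : ℕ → Ω → ℝ) (l k : ℕ) (ω : Ω) : ENNReal :=
  ∫⁻ v, expMart x tag ε l k v ω ∂ρ

lemma measurable_score {m : MeasurableSpace Ω} {x : ℕ → Ω → Arm d} {tag : ℕ → Ω → Option ℕ}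
    {l k : ℕ} (hx : Measurable (x k)) (ht : MeasurableSet {ω | tag k ω = some l}) :
    Measurable fun p : Ω × (Fin d → ℝ) => score x tag l k p.2 p.1 := by
  unfold score
  refine Measurable.ite (ht.preimage measurable_fst) ?_ measurable_const
  simp only [dotProduct]
  fun_prop

lemma measurable_expMart {m : MeasurableSpace Ω} {x : ℕ → Ω → Arm d} {tag : ℕ → Ω → Option ℕ}
    {ε : ℕ → Ω → ℝ} {l k : ℕ} (hx : ∀ i ∈ Finset.Icc 1 k, Measurable (x i))
    (ht : ∀ i ∈ Finset.Icc 1 k, MeasurableSet {ω | tag i ω = some l})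
    (hε : ∀ i ∈ Finset.Icc 1 k, Measurable (ε i)) :
    Measurable fun p : Ω × (Fin d → ℝ) => expMart x tag ε l k p.2 p.1 := by
  unfold expMart
  refine (Real.measurable_exp.comp (Finset.measurable_fun_sum _ fun i hi => ?_)).ennreal_ofReal
  have h1 := measurable_score (d := d) (hx i hi) (ht i hi)
  have h2 := hε i hi
  fun_prop

lemma measurable_score_apply {m : MeasurableSpace Ω} {x : ℕ → Ω → Arm d} {tag : ℕ → Ω → Option ℕ}
    {l k : ℕ} (hx : Measurable (x k)) (ht : MeasurableSet {ω | tag k ω = some l})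
    (v : Fin d → ℝ) : Measurable (score x tag l k v) := by
  have h := (measurable_score (d := d) hx ht).comp (measurable_prodMk_right (y := v))
  exact h

lemma measurable_expMart_apply {m : MeasurableSpace Ω} {x : ℕ → Ω → Arm d}
    {tag : ℕ → Ω → Option ℕ} {ε : ℕ → Ω → ℝ} {l k : ℕ}
    (hx : ∀ i ∈ Finset.Icc 1 k, Measurable (x i))
    (ht : ∀ i ∈ Finset.Icc 1 k, MeasurableSet {ω | tag i ω = some l})
    (hε : ∀ i ∈ Finset.Icc 1 k, Measurable (ε i)) (v : Fin d → ℝ) :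
    Measurable (expMart x tag ε l k v) := by
  have h := (measurable_expMart hx ht hε).comp (measurable_prodMk_right (y := v))
  exact h

lemma measurable_mixMart {m : MeasurableSpace Ω} (ρ : Measure (Fin d → ℝ)) [SFinite ρ]
    {x : ℕ → Ω → Arm d} {tag : ℕ → Ω → Option ℕ}
    {ε : ℕ → Ω → ℝ} {l k : ℕ} (hx : ∀ i ∈ Finset.Icc 1 k, Measurable (x i))
    (ht : ∀ i ∈ Finset.Icc 1 k, MeasurableSet {ω | tag i ω = some l})
    (hε : ∀ i ∈ Finset.Icc 1 k, Measurable (ε i)) :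
    Measurable (mixMart ρ x tag ε l k) :=
  (measurable_expMart hx ht hε).lintegral_prod_right'

lemma expMart_succ (x : ℕ → Ω → Arm d) (tag : ℕ → Ω → Option ℕ) (ε : ℕ → Ω → ℝ) (l k : ℕ)
    (v : Fin d → ℝ) (ω : Ω) :
    expMart x tag ε l (k + 1) v ω = expMart x tag ε l k v ω * ENNReal.ofReal (Real.exp
      (score x tag l (k + 1) v ω * ε (k + 1) ω - score x tag l (k + 1) v ω ^ 2 / 2)) := by
  unfold expMart
  rw [← ENNReal.ofReal_mul (Real.exp_pos _).le, ← Real.exp_add, Finset.sum_Icc_succ_top (by omega)]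

variable {mΩ : MeasurableSpace Ω} {μ : Measure Ω} {𝓕 : Filtration ℕ mΩ} {K : ℕ}
  {x : ℕ → Ω → Arm d} {tag : ℕ → Ω → Option ℕ} {ε : ℕ → Ω → ℝ}

/-- After Tonelli the direction is fixed, and its score in round `k + 1` is known at time `k`, so
the predictable-multiplier bound applies. -/
lemma setLIntegral_mixMart_succ_le [IsFiniteMeasure μ] (ρ : Measure (Fin d → ℝ)) [SFinite ρ]
    (hx : ∀ k ∈ Finset.Icc 1 K, Measurable[𝓕 (k - 1)] (x k))
    (ht : ∀ k ∈ Finset.Icc 1 K, ∀ l : ℕ, MeasurableSet[𝓕 (k - 1)] {ω | tag k ω = some l})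
    (hε : ∀ k ∈ Finset.Icc 1 K, Measurable[𝓕 k] (ε k))
    (hsub : ∀ k ∈ Finset.Icc 1 K, CondSubGaussian (𝓕 (k - 1)) μ 1 (ε k))
    (l k : ℕ) (hk : k < K) (A : Set Ω) (hA : MeasurableSet[𝓕 k] A) :
    ∫⁻ ω in A, mixMart ρ x tag ε l (k + 1) ω ∂μ ≤ ∫⁻ ω in A, mixMart ρ x tag ε l k ω ∂μ := by
  have hK : ∀ i ∈ Finset.Icc 1 (k + 1), i ∈ Finset.Icc 1 K := fun i hi => by
    simp only [Finset.mem_Icc] at hi ⊢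
    omega
  have hk1 : k + 1 ∈ Finset.Icc 1 K := hK _ (by simp)
  have hjoint : ∀ j ≤ k + 1, Measurable fun p : Ω × (Fin d → ℝ) => expMart x tag ε l j p.2 p.1 := by
    intro j hj
    have hj' : ∀ i ∈ Finset.Icc 1 j, i ∈ Finset.Icc 1 K := fun i hi =>
      hK i (Finset.Icc_subset_Icc le_rfl hj hi)
    exact measurable_expMart (fun i hi => (hx i (hj' i hi)).mono (𝓕.le _) le_rfl)
      (fun i hi => 𝓕.le _ _ (ht i (hj' i hi) l)) (fun i hi => (hε i (hj' i hi)).mono (𝓕.le _) le_rfl)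
  have hadapt : ∀ v, Measurable[𝓕 k] (expMart x tag ε l k v) := by
    intro v
    have hik : ∀ i ∈ Finset.Icc 1 k, i ≤ k ∧ i - 1 ≤ k ∧ i ∈ Finset.Icc 1 K := fun i hi => by
      simp only [Finset.mem_Icc] at hi ⊢
      omega
    refine @measurable_expMart_apply d Ω (𝓕 k) x tag ε l k (fun i hi => ?_) (fun i hi => ?_)
      (fun i hi => ?_) v
    · exact (hx i (hik i hi).2.2).mono (𝓕.mono (hik i hi).2.1) le_rfl
    · exact 𝓕.mono (hik i hi).2.1 _ (ht i (hik i hi).2.2 l)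
    · exact (hε i (hik i hi).2.2).mono (𝓕.mono (hik i hi).1) le_rfl
  unfold mixMart
  rw [lintegral_lintegral_swap (f := fun ω v => expMart x tag ε l (k + 1) v ω)
      (hjoint (k + 1) le_rfl).aemeasurable,
    lintegral_lintegral_swap (f := fun ω v => expMart x tag ε l k v ω)
      (hjoint k (by omega)).aemeasurable]
  refine lintegral_mono fun v => ?_
  have hAm : MeasurableSet A := 𝓕.le _ _ hA
  rw [← lintegral_indicator hAm, ← lintegral_indicator hAm]
  have hg : Measurable[𝓕 k] (A.indicator (expMart x tag ε l k v)) :=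
    Measurable.indicator (hadapt v) hA
  have hT : Measurable[𝓕 k] (score x tag l (k + 1) v) :=
    @measurable_score_apply d Ω (𝓕 k) x tag l (k + 1) (hx _ hk1) (ht _ hk1 l) v
  refine le_trans (le_of_eq (lintegral_congr fun ω => ?_))
    ((hsub _ hk1).lintegral_mul_exp_le (𝓕.le k) ((hε _ hk1).mono (𝓕.le _) le_rfl) hT hg)
  classical
  rw [Set.indicator_apply, Set.indicator_apply]
  split_ifs
  · exact expMart_succ x tag ε l k v ω
  · simp

/-- The standard Gaussian prior with precision `reg`, up to normalization. -/
noncomputable def gaussianPrior (d : ℕ) (reg : ℝ) : Measure (Fin d → ℝ) :=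
  volume.withDensity fun v => ENNReal.ofReal (Real.exp (-(reg * (v ⬝ᵥ v)) / 2))

lemma measurable_dotProduct_self : Measurable fun v : Fin d → ℝ => v ⬝ᵥ v := by
  simp only [dotProduct]
  fun_prop

instance (reg : ℝ) : SFinite (gaussianPrior d reg) := by
  unfold gaussianPrior
  infer_instance

/-- The prior contributes `reg • 1` to the quadratic form and the compensators contribute `∑ x_i
x_iᵀ`; together they form the regularized Gram matrix. -/
lemma mixMart_gaussianPrior {reg : ℝ} (hreg : 0 < reg) (x : ℕ → Ω → Arm d)
    (tag : ℕ → Ω → Option ℕ) (ε : ℕ → Ω → ℝ) (l k : ℕ) (ω : Ω) :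
    mixMart (gaussianPrior d reg) x tag ε l k ω =
      ENNReal.ofReal (Real.exp (noiseEnergy reg (fun i => x i ω) (fun i => ε i ω)
          (regressionSet (fun i => tag i ω) k l) / 2))
        * gaussianLIntegral (gram reg (fun i => x i ω) (regressionSet (fun i => tag i ω) k l)) := by
  set U := gram reg (fun i => x i ω) (regressionSet (fun i => tag i ω) k l) with hUdef
  set S := ∑ i ∈ regressionSet (fun i => tag i ω) k l, ε i ω • (x i ω).ofLp
  change _ = ENNReal.ofReal (Real.exp ((S ⬝ᵥ U⁻¹ *ᵥ S) / 2)) * gaussianLIntegral U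
  have hU : U.PosDef := gram_posDef hreg _ _
  have hm := measurable_dotProduct_self (d := d)
  rw [← lintegral_exp_dotProduct_sub_quadForm hU S]
  unfold mixMart gaussianPrior
  rw [lintegral_withDensity_eq_lintegral_mul_non_measurable _ (by fun_prop)
    (Filter.Eventually.of_forall fun v => ENNReal.ofReal_lt_top)]
  refine lintegral_congr fun v => ?_
  rw [Pi.mul_apply, expMart, ← ENNReal.ofReal_mul (Real.exp_pos _).le, ← Real.exp_add]
  congr 2
  have h1 : ∀ i, score x tag l i v ω * ε i ω - score x tag l i v ω ^ 2 / 2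
      = if tag i ω = some l then (v ⬝ᵥ (x i ω).ofLp) * ε i ω - (v ⬝ᵥ (x i ω).ofLp) ^ 2 / 2
        else 0 := fun i => by
    unfold score
    split_ifs <;> simp
  rw [hUdef, dotProduct_gram_mulVec, dotProduct_sum, Finset.sum_congr rfl fun i _ => h1 i,
    ← Finset.sum_filter, Finset.sum_sub_distrib, ← Finset.sum_div]
  have h2 : ∑ i ∈ regressionSet (fun i => tag i ω) k l, v ⬝ᵥ ε i ω • (x i ω).ofLp
      = ∑ i ∈ Finset.Icc 1 k with tag i ω = some l, (v ⬝ᵥ (x i ω).ofLp) * ε i ω :=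
    Finset.sum_congr rfl fun i _ => by rw [dotProduct_smul, smul_eq_mul, mul_comm]
  have h3 : ∑ i ∈ regressionSet (fun i => tag i ω) k l,
        (v ⬝ᵥ (x i ω).ofLp) * ((x i ω).ofLp ⬝ᵥ v)
      = ∑ i ∈ Finset.Icc 1 k with tag i ω = some l, (v ⬝ᵥ (x i ω).ofLp) ^ 2 :=
    Finset.sum_congr rfl fun i _ => by rw [dotProduct_comm _ v, sq]
  rw [h2, h3]
  ring

/-- Self-normalized concentration for `1`-sub-Gaussian noise. -/
lemma exists_selfNormalized_one [IsProbabilityMeasure μ] {reg δ : ℝ} (hreg : 0 < reg) (hδ : 0 < δ)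
    (hx : ∀ k ∈ Finset.Icc 1 K, Measurable[𝓕 (k - 1)] (x k))
    (ht : ∀ k ∈ Finset.Icc 1 K, ∀ l : ℕ, MeasurableSet[𝓕 (k - 1)] {ω | tag k ω = some l})
    (hε : ∀ k ∈ Finset.Icc 1 K, Measurable[𝓕 k] (ε k))
    (hsub : ∀ k ∈ Finset.Icc 1 K, CondSubGaussian (𝓕 (k - 1)) μ 1 (ε k)) (l : ℕ) :
    ∃ N : Set Ω, MeasurableSet N ∧ μ N ≤ ENNReal.ofReal δ ∧ ∀ ω ∉ N, ∀ k ≤ K,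
      noiseEnergy reg (fun i => x i ω) (fun i => ε i ω) (regressionSet (fun i => tag i ω) k l)
        ≤ Real.log ((gram reg (fun i => x i ω) (regressionSet (fun i => tag i ω) k l)).det
            / reg ^ d) + 2 * Real.log (1 / δ) := by
  set F := mixMart (gaussianPrior d reg) x tag ε l with hF
  -- The value of the mixture at time zero, playing the role of the prior's normalization. Ville is
  -- applied at height `Z / δ`, and the Gaussian constant cancels because it is neither zero nor
  -- infinite.
  set Z := ENNReal.ofReal (√(reg ^ d))⁻¹ * gaussianLIntegral (1 : Matrix (Fin d) (Fin d) ℝ) with hZ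
  have hG0 := gaussianLIntegral_ne_zero (1 : Matrix (Fin d) (Fin d) ℝ)
  have hGT := gaussianLIntegral_one_ne_top (d := d)
  have hrd : 0 < √(reg ^ d) := Real.sqrt_pos.2 (by positivity)
  have hZ0 : Z ≠ 0 := mul_ne_zero (by simpa using hrd) hG0
  have hZT : Z ≠ ⊤ := ENNReal.mul_ne_top ENNReal.ofReal_ne_top hGT
  have hFad : ∀ k ≤ K, Measurable[𝓕 k] (F k) := by
    intro k hk
    have hik : ∀ i ∈ Finset.Icc 1 k, i ≤ k ∧ i - 1 ≤ k ∧ i ∈ Finset.Icc 1 K := fun i hi => by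
      simp only [Finset.mem_Icc] at hi ⊢
      omega
    refine @measurable_mixMart d Ω (𝓕 k) _ _ x tag ε l k (fun i hi => ?_) (fun i hi => ?_)
      (fun i hi => ?_)
    · exact (hx i (hik i hi).2.2).mono (𝓕.mono (hik i hi).2.1) le_rfl
    · exact 𝓕.mono (hik i hi).2.1 _ (ht i (hik i hi).2.2 l)
    · exact (hε i (hik i hi).2.2).mono (𝓕.mono (hik i hi).1) le_rfl
  have hF0 : ∫⁻ ω, F 0 ω ∂μ = Z := by
    have : ∀ ω, F 0 ω = Z := fun ω => by
      rw [hF, mixMart_gaussianPrior hreg, gaussianLIntegral_eq (gram_posDef hreg _ _)]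
      simp [regressionSet, noiseEnergy, det_gram_empty, hZ]
    simp [this]
  have hville := mul_measure_exists_le_lintegral (μ := μ) 𝓕 F K hFad
    (fun k hk A hA => setLIntegral_mixMart_succ_le _ hx ht hε hsub l k hk A hA)
    (ENNReal.ofReal (1 / δ) * Z)
  refine ⟨{ω | ∃ k ≤ K, ENNReal.ofReal (1 / δ) * Z ≤ F k ω}, ?_, ?_, ?_⟩
  · have : {ω | ∃ k ≤ K, ENNReal.ofReal (1 / δ) * Z ≤ F k ω}
        = ⋃ k ∈ Finset.range (K + 1), {ω | ENNReal.ofReal (1 / δ) * Z ≤ F k ω} := by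
      ext ω
      simp only [Set.mem_ofPred_eq, Set.mem_iUnion, Finset.mem_range, Nat.lt_succ_iff, exists_prop]
    rw [this]
    refine Finset.measurableSet_biUnion _ fun k hk => measurableSet_le measurable_const ?_
    exact (hFad k (by simpa [Nat.lt_succ_iff] using hk)).mono (𝓕.le k) le_rfl
  · set E := {ω | ∃ k ≤ K, ENNReal.ofReal (1 / δ) * Z ≤ F k ω}
    rw [hF0, mul_comm _ Z, mul_assoc] at hville
    have h2 := (ENNReal.mul_le_mul_iff_right hZ0 hZT).1 (hville.trans_eq (mul_one Z).symm)
    have h3 : ENNReal.ofReal δ * ENNReal.ofReal (1 / δ) = 1 := by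
      rw [← ENNReal.ofReal_mul hδ.le, mul_one_div_cancel hδ.ne', ENNReal.ofReal_one]
    calc μ E = ENNReal.ofReal δ * (ENNReal.ofReal (1 / δ) * μ E) := by
            rw [← mul_assoc, h3, one_mul]
      _ ≤ ENNReal.ofReal δ * 1 := by gcongr
      _ = _ := mul_one _
  · intro ω hω k hk
    set U := gram reg (fun i => x i ω) (regressionSet (fun i => tag i ω) k l)
    have hU : U.PosDef := gram_posDef hreg _ _
    have hdet := hU.det_pos
    have h1 : F k ω < ENNReal.ofReal (1 / δ) * Z := by
      by_contra hcon
      exact hω ⟨k, hk, not_lt.1 hcon⟩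
    rw [hF, mixMart_gaussianPrior hreg, gaussianLIntegral_eq hU, hZ, ← mul_assoc, ← mul_assoc,
      ENNReal.mul_lt_mul_iff_left hG0 hGT, ← ENNReal.ofReal_mul (Real.exp_pos _).le,
      ← ENNReal.ofReal_mul (by positivity), ENNReal.ofReal_lt_ofReal_iff (by positivity)] at h1
    have h2 := Real.log_lt_log (by positivity) h1
    rw [Real.log_mul (by positivity) (by positivity), Real.log_mul (by positivity) (by positivity),
      Real.log_exp, Real.log_inv, Real.log_inv, Real.log_sqrt hdet.le,
      Real.log_sqrt (by positivity)] at h2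
    rw [Real.log_div hdet.ne' (by positivity)]
    linarith

/-- Self-normalized concentration for `R`-sub-Gaussian noise. -/
lemma exists_selfNormalized [IsProbabilityMeasure μ] {reg δ R : ℝ} (hreg : 0 < reg) (hδ : 0 < δ)
    (hR : 0 ≤ R)
    (hx : ∀ k ∈ Finset.Icc 1 K, Measurable[𝓕 (k - 1)] (x k))
    (ht : ∀ k ∈ Finset.Icc 1 K, ∀ l : ℕ, MeasurableSet[𝓕 (k - 1)] {ω | tag k ω = some l})
    (hε : ∀ k ∈ Finset.Icc 1 K, Measurable[𝓕 k] (ε k))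
    (hsub : ∀ k ∈ Finset.Icc 1 K, CondSubGaussian (𝓕 (k - 1)) μ R (ε k)) (l : ℕ) :
    ∃ N : Set Ω, MeasurableSet N ∧ μ N ≤ ENNReal.ofReal δ ∧ ∀ ω ∉ N, ∀ k ≤ K,
      noiseEnergy reg (fun i => x i ω) (fun i => ε i ω) (regressionSet (fun i => tag i ω) k l)
        ≤ R ^ 2 * (Real.log ((gram reg (fun i => x i ω) (regressionSet (fun i => tag i ω) k l)).det
            / reg ^ d) + 2 * Real.log (1 / δ)) := by
  rcases hR.eq_or_lt with rfl | hR
  · refine ⟨⋃ k ∈ Finset.Icc 1 K, {ω | ε k ω ≠ 0}, ?_, ?_, ?_⟩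
    · refine Finset.measurableSet_biUnion _ fun k hk => ?_
      exact ((hε k hk).mono (𝓕.le k) le_rfl (measurableSet_singleton 0)).compl
    · refine le_trans (le_of_eq ?_) zero_le
      refine (measure_biUnion_null_iff (Finset.countable_toSet (Finset.Icc 1 K))).2 ?_
      exact fun k hk => ae_iff.1 ((hsub k hk).ae_eq_zero (𝓕.le _))
    · intro ω hω k hk
      have hS : ∑ i ∈ regressionSet (fun i => tag i ω) k l, ε i ω • (x i ω).ofLp = 0 := Finset.sum_eq_zero fun i hi => by
        have hi' : i ∈ Finset.Icc 1 K :=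
          Finset.Icc_subset_Icc le_rfl hk (Finset.mem_filter.1 hi).1
        have : ε i ω = 0 := by
          by_contra h
          exact hω (Set.mem_biUnion hi' h)
        rw [this, zero_smul]
      rw [noiseEnergy, hS]
      simp
  -- Rescaling by `R⁻¹` reduces to unit variance proxy and divides the energy by `R ^ 2`.
  · obtain ⟨N, hN, hμ, h⟩ := exists_selfNormalized_one (μ := μ) (ε := fun k ω => R⁻¹ * ε k ω)
      hreg hδ hx ht (fun k hk => (hε k hk).const_mul _) (fun k hk => by
        have := (hsub k hk).const_mul R⁻¹
        rwa [inv_mul_cancel₀ hR.ne'] at this) l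
    refine ⟨N, hN, hμ, fun ω hω k hk => ?_⟩
    have h1 := h ω hω k hk
    rw [noiseEnergy_const_mul, inv_pow, inv_mul_le_iff₀ (by positivity)] at h1
    exact h1

end SelfNormalized

/-! ### Error of the ridge estimator under misspecification -/

section Estimation

variable {d : ℕ}

lemma abs_dotProduct_ridge_sub_le {reg B ζ ρ : ℝ} (hB : 0 < B) (hreg : reg = B ^ (-2 : ℤ))
    (hζ : 0 ≤ ζ) (hρ : 0 ≤ ρ) {x : ℕ → Arm d} {f ε : ℕ → ℝ} {C : Finset ℕ} {θ : Arm d}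
    (hθ : ‖θ‖ ≤ B) (hf : ∀ i ∈ C, |f i - (x i).ofLp ⬝ᵥ θ.ofLp| ≤ ζ)
    (hnoise : noiseEnergy reg x ε C ≤ ρ ^ 2) (v : Arm d) :
    |v.ofLp ⬝ᵥ ridge reg x (fun i => f i + ε i) C - v.ofLp ⬝ᵥ θ.ofLp|
      ≤ (1 + ρ + ζ * √C.card) * uncertainty reg x C v := by
  have hreg' : reg = (B ^ 2)⁻¹ := by rw [hreg, zpow_neg]; norm_cast
  have hreg0 : 0 < reg := by rw [hreg']; positivity
  have hU := gram_posDef hreg0 x C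
  have hun : uncertainty reg x C v = √(v.ofLp ⬝ᵥ (gram reg x C)⁻¹ *ᵥ v.ofLp) := rfl
  have hcs := fun w : Fin d → ℝ => abs_dotProduct_mulVec_le hU.inv.posSemidef v.ofLp w
  rw [← hun] at hcs
  have hsq := sum_sq_le_quadForm_gram_inv hreg0 x C v.ofLp
  have hq0 := quadForm_inv_nonneg hU v.ofLp
  have hun2 : uncertainty reg x C v ^ 2 = v.ofLp ⬝ᵥ (gram reg x C)⁻¹ *ᵥ v.ofLp := weightedNorm_sq hU v
  have hun0 : 0 ≤ uncertainty reg x C v := Real.sqrt_nonneg _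
  unfold noiseEnergy at hnoise
  have hθq := reg_mul_quadForm_gram_inv_le hreg0 x C θ.ofLp
  set U := gram reg x C with hUdef
  set η : ℕ → ℝ := fun i => f i - (x i).ofLp ⬝ᵥ θ.ofLp with hη
  have hUθ : U *ᵥ θ.ofLp = reg • θ.ofLp + ∑ i ∈ C, ((x i).ofLp ⬝ᵥ θ.ofLp) • (x i).ofLp := by
    rw [hUdef, gram, Matrix.add_mulVec, Matrix.smul_mulVec, Matrix.one_mulVec, Matrix.sum_mulVec]
    congr 1
    refine Finset.sum_congr rfl fun i _ => ?_
    rw [Matrix.vecMulVec_mulVec]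
    ext
    simp [mul_comm]
  -- Beyond `U θ`, the response splits into noise, misspecification `η` and regularization bias,
  -- whose contributions are bounded in `h1`, `h2` and `h3`.
  have hsplit : ∑ i ∈ C, (f i + ε i) • (x i).ofLp
      = U *ᵥ θ.ofLp + (∑ i ∈ C, ε i • (x i).ofLp + ∑ i ∈ C, η i • (x i).ofLp - reg • θ.ofLp) := by
    rw [hUθ]
    have : ∑ i ∈ C, (f i + ε i) • (x i).ofLp = ∑ i ∈ C, ((x i).ofLp ⬝ᵥ θ.ofLp) • (x i).ofLp
        + (∑ i ∈ C, ε i • (x i).ofLp + ∑ i ∈ C, η i • (x i).ofLp) := by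
      rw [← Finset.sum_add_distrib, ← Finset.sum_add_distrib]
      refine Finset.sum_congr rfl fun i _ => ?_
      rw [← add_smul, ← add_smul]
      congr 1
      simp only [hη]
      ring
    rw [this]
    abel
  have hinv : U⁻¹ *ᵥ (U *ᵥ θ.ofLp) = θ.ofLp := by
    rw [Matrix.mulVec_mulVec, Matrix.nonsing_inv_mul _ (posDef_det_isUnit hU), Matrix.one_mulVec]
  have hdiff : v.ofLp ⬝ᵥ ridge reg x (fun i => f i + ε i) C - v.ofLp ⬝ᵥ θ.ofLp
      = v.ofLp ⬝ᵥ U⁻¹ *ᵥ (∑ i ∈ C, ε i • (x i).ofLp)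
        + ∑ i ∈ C, η i * (v.ofLp ⬝ᵥ U⁻¹ *ᵥ (x i).ofLp) - reg * (v.ofLp ⬝ᵥ U⁻¹ *ᵥ θ.ofLp) := by
    have hsum : v.ofLp ⬝ᵥ U⁻¹ *ᵥ (∑ i ∈ C, η i • (x i).ofLp)
        = ∑ i ∈ C, η i * (v.ofLp ⬝ᵥ U⁻¹ *ᵥ (x i).ofLp) := by
      rw [Matrix.mulVec_sum, dotProduct_sum]
      simp only [Matrix.mulVec_smul, dotProduct_smul, smul_eq_mul]
    rw [ridge, ← hUdef, hsplit, Matrix.mulVec_add, hinv, Matrix.mulVec_sub, Matrix.mulVec_add,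
      Matrix.mulVec_smul, dotProduct_add, dotProduct_sub, dotProduct_add, dotProduct_smul,
      hsum, smul_eq_mul]
    ring
  have h1 : |v.ofLp ⬝ᵥ U⁻¹ *ᵥ (∑ i ∈ C, ε i • (x i).ofLp)| ≤ uncertainty reg x C v * ρ :=
    (hcs _).trans (by gcongr; exact Real.sqrt_le_iff.2 ⟨hρ, hnoise⟩)
  have h2 : |∑ i ∈ C, η i * (v.ofLp ⬝ᵥ U⁻¹ *ᵥ (x i).ofLp)|
      ≤ ζ * √C.card * uncertainty reg x C v := by
    have hη2 : ∑ i ∈ C, η i ^ 2 ≤ C.card * ζ ^ 2 := by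
      rw [← nsmul_eq_mul]
      exact Finset.sum_le_card_nsmul _ _ _ fun i hi => by
        rw [← sq_abs]
        have := hf i hi
        gcongr
    have hcauchy := Finset.sum_mul_sq_le_sq_mul_sq C η fun i => v.ofLp ⬝ᵥ U⁻¹ *ᵥ (x i).ofLp
    refine abs_le_of_sq_le_sq (hcauchy.trans ?_) (by positivity)
    rw [mul_pow, mul_pow, Real.sq_sqrt (by positivity), hun2, mul_comm (ζ ^ 2)]
    exact mul_le_mul hη2 hsq (Finset.sum_nonneg fun i _ => sq_nonneg _) (by positivity)
  have h3 : |reg * (v.ofLp ⬝ᵥ U⁻¹ *ᵥ θ.ofLp)| ≤ uncertainty reg x C v := by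
    -- The choice `reg = B⁻²` makes the regularization bias at most one uncertainty; it is the `1`
    -- in `radius`.
    have h4 : reg * √(θ.ofLp ⬝ᵥ U⁻¹ *ᵥ θ.ofLp) ≤ 1 := by
      rw [dotProduct_self_eq_norm_sq] at hθq
      have h5 : ‖θ‖ ^ 2 ≤ B ^ 2 := by gcongr
      have h6 : reg * B ^ 2 = 1 := by rw [hreg', inv_mul_cancel₀ (by positivity)]
      refine abs_le_one_iff_mul_self_le_one.2 ?_ |> (le_abs_self _).trans
      have h7 := mul_le_mul_of_nonneg_left (hθq.trans h5) hreg0.le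
      rw [mul_mul_mul_comm, Real.mul_self_sqrt (quadForm_inv_nonneg hU θ.ofLp), mul_assoc]
      linarith
    rw [abs_mul, abs_of_pos hreg0]
    calc reg * |v.ofLp ⬝ᵥ U⁻¹ *ᵥ θ.ofLp|
        ≤ reg * (uncertainty reg x C v * √(θ.ofLp ⬝ᵥ U⁻¹ *ᵥ θ.ofLp)) := by gcongr; exact hcs _
      _ = uncertainty reg x C v * (reg * √(θ.ofLp ⬝ᵥ U⁻¹ *ᵥ θ.ofLp)) := by ring
      _ ≤ uncertainty reg x C v * 1 := by gcongr
      _ = _ := mul_one _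
  rw [hdiff]
  refine (abs_sub _ _).trans ((add_le_add (abs_add_le _ _) le_rfl).trans ?_)
  linarith

end Estimation

/-! ### Elimination within one round -/

section Algorithm

variable {d : ℕ} {reg : ℝ} {β : ℕ → ℝ} {k : ℕ} {x : ℕ → Arm d} {y : ℕ → ℝ} {C : ℕ → Finset ℕ}

lemma RoundFrom.mem {l : ℕ} {A : Set (Arm d)} {v : Arm d} {t : Option ℕ}
    (h : RoundFrom reg β k x y C l A v t) : v ∈ A := by
  induction h with
  | explore l A v hv _ _ => exact hv
  | exploit l A v _ _ hv _ => exact hv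
  | eliminate l A m v t _ _ _ _ _ ih => exact ih.1

lemma RoundFrom.le_uncertainty {l : ℕ} {A : Set (Arm d)} {v : Arm d} {t : Option ℕ}
    (h : RoundFrom reg β k x y C l A v t) {j : ℕ} (ht : t = some j) :
    (1 / 2 : ℝ) ^ j ≤ uncertainty reg x (C j) v := by
  induction h with
  | explore l A v hv _ hlarge =>
    obtain rfl := Option.some.inj ht
    exact hlarge
  | exploit l A v _ _ hv _ => cases ht
  | eliminate l A m v t _ _ _ _ _ ih => exact ih ht

/-- The last three hypotheses are the loop invariant: some optimal arm survives, surviving gaps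
shrink like `2 ^ (-l)`, and past `lΔ` every survivor is optimal. No estimate is then needed at the
deeper levels. -/
lemma RoundFrom.gap_cases {r : Arm d → ℝ} {D : Set (Arm d)} {z b Δ : ℝ} {lΔ : ℕ}
    (hβ : ∀ j, 0 ≤ β j) (hb : ∀ j ≤ lΔ, β j ≤ b) (hz : 4 * z < Δ)
    (hcrit : 8 * b * (1 / 2 : ℝ) ^ lΔ < Δ)
    (hest : ∀ j, 1 ≤ j → j ≤ lΔ → ∀ v ∈ D, uncertainty reg x (C j) v < (1 / 2 : ℝ) ^ j →
      |v.ofLp ⬝ᵥ ridge reg x y (C j) - r v| ≤ β j * uncertainty reg x (C j) v + z)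
    (hgap : ∀ v ∈ D, 0 < gap r D v → Δ ≤ gap r D v) (hgap0 : ∀ v ∈ D, 0 ≤ gap r D v)
    {l : ℕ} {A : Set (Arm d)} {v : Arm d} {t : Option ℕ}
    (h : RoundFrom reg β k x y C l A v t) (hl : 1 ≤ l) (hA : A ⊆ D)
    (hopt : l ≤ lΔ → ∃ w ∈ A, gap r D w = 0)
    (hle : l ≤ lΔ → ∀ a ∈ A, gap r D a ≤ 16 * b * (1 / 2 : ℝ) ^ l)
    (hzero : lΔ < l → ∀ a ∈ A, gap r D a = 0) :
    gap r D v = 0 ∨ ∃ j ∈ Finset.Icc 1 lΔ,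
      (t = some j ∧ gap r D v ≤ 16 * b * (1 / 2 : ℝ) ^ j) ∨
      (k ≤ 4 ^ j * d ∧ gap r D v ≤ 4 * b * (1 / 2 : ℝ) ^ j) := by
  have hucb : ∀ j, 1 ≤ j → j ≤ lΔ → ∀ a ∈ D, uncertainty reg x (C j) a < (1 / 2 : ℝ) ^ j →
      r a - z ≤ ucb reg (β j) x y (C j) a ∧
        ucb reg (β j) x y (C j) a ≤ r a + 2 * (β j * (1 / 2 : ℝ) ^ j) + z := by
    intro j h1 h2 a ha hs
    have h3 := abs_le.1 (hest j h1 h2 a ha hs)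
    have h4 := mul_le_mul_of_nonneg_left hs.le (hβ j)
    unfold ucb
    constructor <;> linarith [h3.1, h3.2]
  have hgapeq : ∀ w a, gap r D w = 0 → gap r D a = r w - r a := by
    intro w a hw
    unfold gap at *
    linarith
  have hpow : ∀ j : ℕ, (0 : ℝ) < (1 / 2) ^ j := fun j => by positivity
  induction h with
  | explore l A v hv _ _ =>
    by_cases hll : l ≤ lΔ
    · exact Or.inr ⟨l, by simp [hl, hll], Or.inl ⟨rfl, hle hll v hv⟩⟩
    · exact Or.inl (hzero (by omega) v hv)
  | exploit l A v hsmall hk hv hmax =>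
    by_cases hll : l ≤ lΔ
    · rcases (hgap0 v (hA hv)).eq_or_lt with h0 | h0
      · exact Or.inl h0.symm
      · obtain ⟨w, hw, hw0⟩ := hopt hll
        have h1 := (hucb l hl hll w (hA hw) (hsmall w hw)).1
        have h2 := (hucb l hl hll v (hA hv) (hsmall v hv)).2
        have h3 := hmax w hw
        have h4 := hgapeq w v hw0
        have h5 := hgap v (hA hv) h0
        have h6 := mul_le_mul_of_nonneg_right (hb l hll) (hpow l).le
        -- The gap is at most `2 β 2 ^ (-l) + 2 z`, and `2 z < Δ / 2` is below half the gap.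
        exact Or.inr ⟨l, by simp [hl, hll], Or.inr ⟨hk, by linarith⟩⟩
    · exact Or.inl (hzero (by omega) v hv)
  | eliminate l A m v t hsmall hk hm hmax hnext ih =>
    have hm' : m ∈ {w ∈ A | ucb reg (β l) x y (C l) m - ucb reg (β l) x y (C l) w
          ≤ 2 * β l * (1 / 2 : ℝ) ^ l} := by
      refine ⟨hm, ?_⟩
      have := mul_nonneg (hβ l) (hpow l).le
      linarith
    have hbound : l ≤ lΔ → ∀ a ∈ {w ∈ A | ucb reg (β l) x y (C l) m - ucb reg (β l) x y (C l) w
          ≤ 2 * β l * (1 / 2 : ℝ) ^ l}, 0 < gap r D a → gap r D a ≤ 8 * b * (1 / 2 : ℝ) ^ l := by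
      rintro hll a ⟨ha, hkeep⟩ h0
      obtain ⟨w, hw, hw0⟩ := hopt hll
      have h1 := (hucb l hl hll w (hA hw) (hsmall w hw)).1
      have h2 := (hucb l hl hll a (hA ha) (hsmall a ha)).2
      have h3 := hmax w hw
      have h4 := hgapeq w a hw0
      have h5 := hgap a (hA ha) h0
      have h6 := mul_le_mul_of_nonneg_right (hb l hll) (hpow l).le
      -- Survival costs a further `2 β 2 ^ (-l)`: the gap is at most `4 β 2 ^ (-l) + 2 z`, and half
      -- of it absorbs `2 z`.
      linarith
    refine ih (by omega) (fun a ha => hA ha.1) ?_ ?_ ?_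
    · intro hll
      obtain ⟨w, hw, hw0⟩ := hopt (by omega)
      by_cases hkeep : ucb reg (β l) x y (C l) m - ucb reg (β l) x y (C l) w
          ≤ 2 * β l * (1 / 2 : ℝ) ^ l
      · exact ⟨w, ⟨hw, hkeep⟩, hw0⟩
      -- If the optimal arm `w` is eliminated, the index of `m` exceeds that of `w` by so much that
      -- the gap of `m` is below `2 z < Δ`. Hence `m` is optimal and replaces `w`.
      · refine ⟨m, hm', ?_⟩
        by_contra hne
        have h1 := (hucb l hl (by omega) w (hA hw) (hsmall w hw)).1
        have h2 := (hucb l hl (by omega) m (hA hm) (hsmall m hm)).2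
        have h4 := hgapeq w m hw0
        have h5 := hgap m (hA hm) ((hgap0 m (hA hm)).lt_of_ne' hne)
        have h6 := hgap0 m (hA hm)
        linarith
    · intro hll a ha
      rcases (hgap0 a (hA ha.1)).eq_or_lt with h0 | h0
      · rw [← h0]
        have := (hβ l).trans (hb l (by omega))
        positivity
      · refine (hbound (by omega) a ha h0).trans_eq ?_
        rw [pow_succ]
        ring
    · intro hll a ha
      by_contra hne
      have h0 := (hgap0 a (hA ha.1)).lt_of_ne' hne
      rcases Nat.lt_or_ge lΔ l with h1 | h1
      · exact hne (hzero h1 a ha.1)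
      · obtain rfl : l = lΔ := by omega
        have h2 := hbound le_rfl a ha h0
        have h3 := hgap a (hA ha.1) h0
        linarith

end Algorithm

/-! ### Optimal arms, sizes of the regression sets, confidence radius -/

section Regret

variable {d : ℕ}

lemma optReward_spec {r : Arm d → ℝ} {A : Set (Arm d)} (hne : A.Nonempty)
    (hr : ∀ v ∈ A, 0 ≤ r v ∧ r v ≤ 1) :
    (∀ v ∈ A, 0 ≤ gap r A v ∧ gap r A v ≤ 1) ∧ ∀ η > 0, ∃ v ∈ A, gap r A v < η := by
  have hbdd : BddAbove (r '' A) := ⟨1, by rintro _ ⟨v, hv, rfl⟩; exact (hr v hv).2⟩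
  have h1 : optReward r A ≤ 1 :=
    csSup_le (hne.image r) (by rintro _ ⟨v, hv, rfl⟩; exact (hr v hv).2)
  refine ⟨fun v hv => ⟨?_, ?_⟩, fun η hη => ?_⟩
  · exact sub_nonneg.2 (le_csSup hbdd (Set.mem_image_of_mem r hv))
  · have := (hr v hv).1
    unfold gap
    linarith
  · obtain ⟨_, ⟨v, hv, rfl⟩, h⟩ := exists_lt_of_lt_csSup (hne.image r)
      (show sSup (r '' A) - η < sSup (r '' A) by linarith)
    refine ⟨v, hv, ?_⟩
    unfold gap optReward
    linarith

/-- No compactness is assumed: an arm within `Δ` of the supremum cannot have a positive gap, so the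
supremum is attained. -/
lemma exists_gap_eq_zero {r : Arm d → ℝ} {A : Set (Arm d)} {Δ : ℝ} (hΔ : 0 < Δ)
    (hne : A.Nonempty) (hr : ∀ v ∈ A, 0 ≤ r v ∧ r v ≤ 1)
    (hgap : ∀ v ∈ A, 0 < gap r A v → Δ ≤ gap r A v) : ∃ v ∈ A, gap r A v = 0 := by
  obtain ⟨h1, h2⟩ := optReward_spec hne hr
  obtain ⟨v, hv, h⟩ := h2 Δ hΔ
  refine ⟨v, hv, le_antisymm (not_lt.1 fun h0 => ?_) (h1 v hv).1⟩
  linarith [hgap v hv h0]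

variable {R L B ζ Δ δ : ℝ} {lΔ K : ℕ} {D : ℕ → Set (Arm d)} {x : ℕ → Arm d} {y : ℕ → ℝ}
  {tag : ℕ → Option ℕ} {β : ℕ → ℝ}

lemma IsRun.mem {reg : ℝ} (h : IsRun reg β K D x y tag) {k : ℕ} (hk : k ∈ Finset.Icc 1 K) :
    x k ∈ D k := (h k hk).mem

lemma zpow_neg_two_pos (hB : 1 ≤ B) : 0 < B ^ (-2 : ℤ) := zpow_pos (by linarith) _

lemma log_det_gram_le (hd : 0 < d) (hB : 1 ≤ B) {C : Finset ℕ} (hx : ∀ i ∈ C, ‖x i‖ ≤ L) :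
    Real.log ((gram (B ^ (-2 : ℤ)) x C).det / (B ^ (-2 : ℤ)) ^ d)
      ≤ d * Real.log (1 + C.card * (L * B) ^ 2 / d) := by
  have hreg := zpow_neg_two_pos hB
  have hd' : (0 : ℝ) < d := by exact_mod_cast hd
  have hdet := (gram_posDef hreg x C).det_pos
  rw [← Real.log_pow]
  refine Real.log_le_log (by positivity) ?_
  rw [div_le_iff₀ (by positivity), mul_comm]
  refine (det_gram_le hd hreg hx).trans_eq ?_
  have hB0 : B ≠ 0 := by positivity
  congr 3
  rw [zpow_neg]
  norm_cast
  field_simp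

lemma IsRun.card_regressionSet_le (hd : 0 < d) (hL : 1 ≤ L) (hB : 1 ≤ B)
    (h : IsRun (B ^ (-2 : ℤ)) β K D x y tag) (hx : ∀ k ∈ Finset.Icc 1 K, ‖x k‖ ≤ L) {k l : ℕ}
    (hk : k ≤ K) (hl : 1 ≤ l) :
    ((regressionSet tag k l).card : ℝ) ≤ 3 * d * 4 ^ l * iota1 L B l := by
  have hreg := zpow_neg_two_pos hB
  have hsub : Finset.Icc 1 k ⊆ Finset.Icc 1 K := Finset.Icc_subset_Icc le_rfl hk
  have h1 := pow_card_le_det_gram (a := (1 / 2) ^ l) hreg (by positivity) x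
    (fun i => tag i = some l) k fun i hi ht => (h i (hsub hi)).le_uncertainty ht
  have h2 := log_det_gram_le (x := x) (C := regressionSet tag k l) hd hB
    fun i hi => hx i (hsub (Finset.mem_filter.1 hi).1)
  refine card_le_of_mul_log_le (by exact_mod_cast hd) hL hB (by positivity) (le_trans ?_ h2) hl
  rw [← Real.log_pow]
  refine Real.log_le_log (by positivity) ?_
  rw [le_div_iff₀ (by positivity), mul_comm]
  have h4 : ((1 / 2 : ℝ) ^ l) ^ 2 = (1 / 4) ^ l := by rw [← pow_mul, mul_comm, pow_mul]; norm_num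
  rwa [h4] at h1

lemma IsRun.noise_radius_le (hd : 0 < d) (hL : 1 ≤ L) (hB : 1 ≤ B) (hδ : 0 < δ) (hδ1 : δ < 1)
    (h : IsRun (B ^ (-2 : ℤ)) β K D x y tag) (hx : ∀ k ∈ Finset.Icc 1 K, ‖x k‖ ≤ L) {k l : ℕ}
    (hk : k ≤ K) (hl : 1 ≤ l) :
    Real.log ((gram (B ^ (-2 : ℤ)) x (regressionSet tag k l)).det / (B ^ (-2 : ℤ)) ^ d)
      + 2 * Real.log (1 / (δ * (1 / 2) ^ l)) ≤ 2 * d * iota2 L B δ l := by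
  have hd' : (0 : ℝ) < d := by exact_mod_cast hd
  have hd1 : (1 : ℝ) ≤ d := by exact_mod_cast hd
  have hι := one_le_iota1 hL hB l
  have hcard := h.card_regressionSet_le hd hL hB hx hk hl
  have h1 := log_det_gram_le (x := x) (C := regressionSet tag k l) hd hB
    fun i hi => hx i (Finset.Icc_subset_Icc le_rfl hk (Finset.mem_filter.1 hi).1)
  have h2 : Real.log (1 + (regressionSet tag k l).card * (L * B) ^ 2 / d)
      ≤ Real.log (1 + 16 * L ^ 2 * B ^ 2 * 4 ^ l * iota1 L B l) := by
    refine Real.log_le_log (by positivity) (add_le_add le_rfl ?_)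
    rw [div_le_iff₀ hd']
    calc ((regressionSet tag k l).card : ℝ) * (L * B) ^ 2
        ≤ 3 * d * 4 ^ l * iota1 L B l * (L * B) ^ 2 := by gcongr
      _ = 3 * (L ^ 2 * B ^ 2 * 4 ^ l * iota1 L B l * d) := by ring
      _ ≤ 16 * (L ^ 2 * B ^ 2 * 4 ^ l * iota1 L B l * d) := by gcongr; norm_num
      _ = _ := by ring
  have h3 : iota2 L B δ l = Real.log (1 / (δ * (1 / 2) ^ l))
      + Real.log (1 + 16 * L ^ 2 * B ^ 2 * 4 ^ l * iota1 L B l) := by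
    rw [← Real.log_mul (by positivity) (by positivity), iota2]
    congr 1
    have h8 : (8 : ℝ) ^ l = 2 ^ l * 4 ^ l := by rw [← mul_pow]; norm_num
    rw [h8, one_div_pow]
    field_simp
  have h4 : 0 ≤ Real.log (1 / (δ * (1 / 2) ^ l)) := by
    refine Real.log_nonneg ?_
    rw [le_div_iff₀ (by positivity), one_mul]
    exact mul_le_one₀ hδ1.le (by positivity) (pow_le_one₀ (by norm_num) (by norm_num))
  have h5 : 0 ≤ Real.log (1 + 16 * L ^ 2 * B ^ 2 * 4 ^ l * iota1 L B l) :=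
    Real.log_nonneg (le_add_of_nonneg_right (by positivity))
  rw [h3]
  have h6 := mul_le_mul_of_nonneg_left h2 hd'.le
  -- With `X` the determinant term and `Y = log (1 / (δ 2 ^ (-l)))`, this is `d X + 2 Y ≤ 2 d (X +
  -- Y)`, true as `X, Y ≥ 0` and `d ≥ 1`.
  nlinarith

end Regret

/-! ### Summation over levels and the deterministic regret bound -/

section RegretBound

variable {d : ℕ} {R L B ζ Δ δ : ℝ} {lΔ K : ℕ}

lemma regretBound_nonneg (hL : 1 ≤ L) (hB : 1 ≤ B) (hΔ : 0 < Δ) :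
    0 ≤ regretBound d R L B δ Δ lΔ := by
  have := one_le_iota1 hL hB lΔ
  unfold regretBound
  positivity

lemma IsCriticalLevel.lt {β : ℕ → ℝ} (hβ : 0 < β lΔ) (hΔ : 0 < Δ) (h : IsCriticalLevel β Δ lΔ) :
    8 * β lΔ * (1 / 2 : ℝ) ^ lΔ < Δ := by
  have h1 := h.1.2
  rw [Real.logb_lt_iff_lt_rpow (by norm_num) (by positivity), Real.rpow_natCast,
    div_lt_iff₀ hΔ] at h1
  rw [one_div_pow, mul_one_div, div_lt_iff₀ (by positivity)]
  linarith

lemma IsCriticalLevel.le_logb {β : ℕ → ℝ} (h : IsCriticalLevel β Δ lΔ) (hl : lΔ ≠ 1) :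
    ∃ j, lΔ = j + 1 ∧ (j : ℝ) ≤ Real.logb 2 (8 * β j / Δ) := by
  have h0 : 0 < lΔ := h.1.1
  refine ⟨lΔ - 1, by omega, ?_⟩
  by_contra hlt
  have := h.2 (show lΔ - 1 ∈ {j : ℕ | 0 < j ∧ Real.logb 2 (8 * β j / Δ) < j} from
    ⟨by omega, not_le.1 hlt⟩)
  omega

/-- By minimality the level `lΔ - 1` fails the defining inequality, unless `lΔ = 1`, where `Δ ≤ 1`
suffices. -/
lemma IsCriticalLevel.pow_le {β : ℕ → ℝ} (hβ : ∀ j, 1 ≤ β j) (hmono : Monotone β) (hΔ : 0 < Δ)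
    (hΔ1 : Δ ≤ 1) (h : IsCriticalLevel β Δ lΔ) : (2 : ℝ) ^ lΔ * Δ ≤ 16 * β lΔ := by
  by_cases hl : lΔ = 1
  · subst hl
    linarith [hβ 1]
  · obtain ⟨j, rfl, hj⟩ := h.le_logb hl
    have hj0 := hβ j
    rw [Real.le_logb_iff_rpow_le (by norm_num) (by positivity), Real.rpow_natCast,
      le_div_iff₀ hΔ] at hj
    have := hmono j.le_succ
    rw [pow_succ]
    linarith

lemma sum_Icc_two_pow_le (n : ℕ) : ∑ j ∈ Finset.Icc 1 n, (2 : ℝ) ^ j ≤ 2 * 2 ^ n := by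
  induction n with
  | zero => simp
  | succ n ih =>
    rw [Finset.sum_Icc_succ_top (by omega), pow_succ]
    linarith

lemma card_Icc_filter_le (K n : ℕ) : ((Finset.Icc 1 K).filter (· ≤ n)).card ≤ n := by
  calc ((Finset.Icc 1 K).filter (· ≤ n)).card ≤ (Finset.Icc 1 n).card :=
        Finset.card_le_card fun k hk => by
          simp only [Finset.mem_filter, Finset.mem_Icc] at hk ⊢
          omega
    _ = n := by simp

/-- Each nonzero gap is charged to one level: either its regression set, or the first `4 ^ j * d`
rounds. Level `j` then costs `3 * 16 + 4 = 52` times `d ι b 2 ^ j`, and the geometric sum doubles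
this. -/
lemma sum_gap_le {g : ℕ → ℝ} {tag : ℕ → Option ℕ} {b ι : ℝ} (hb : 0 ≤ b)
    (hcard : ∀ l, 1 ≤ l → l ≤ lΔ → ((regressionSet tag K l).card : ℝ) ≤ 3 * d * 4 ^ l * ι)
    (hι : 1 ≤ ι)
    (hg : ∀ k ∈ Finset.Icc 1 K, g k = 0 ∨ ∃ j ∈ Finset.Icc 1 lΔ,
      (tag k = some j ∧ g k ≤ 16 * b * (1 / 2 : ℝ) ^ j) ∨
      (k ≤ 4 ^ j * d ∧ g k ≤ 4 * b * (1 / 2 : ℝ) ^ j)) :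
    ∑ k ∈ Finset.Icc 1 K, g k ≤ 104 * d * ι * b * 2 ^ lΔ := by
  set e : ℕ → ℕ → ℝ := fun k j => (if tag k = some j then 16 * b * (1 / 2 : ℝ) ^ j else 0)
    + (if k ≤ 4 ^ j * d then 4 * b * (1 / 2 : ℝ) ^ j else 0) with he
  have he0 : ∀ k j, 0 ≤ e k j := fun k j => by
    simp only [he]
    positivity
  have h1 : ∀ k ∈ Finset.Icc 1 K, g k ≤ ∑ j ∈ Finset.Icc 1 lΔ, e k j := by
    intro k hk
    rcases hg k hk with h | ⟨j, hj, h⟩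
    · rw [h]
      exact Finset.sum_nonneg fun j _ => he0 k j
    · refine le_trans ?_ (Finset.single_le_sum (fun j _ => he0 k j) hj)
      have hp : 0 ≤ b * (1 / 2 : ℝ) ^ j := by positivity
      simp only [he]
      rcases h with ⟨h, hle⟩ | ⟨h, hle⟩
      · rw [if_pos h]
        split_ifs <;> linarith
      · rw [if_pos h]
        split_ifs <;> linarith
  have hpow : ∀ j : ℕ, (4 : ℝ) ^ j * (1 / 2) ^ j = 2 ^ j := fun j => by
    rw [← mul_pow]
    norm_num
  have h2 : ∀ j ∈ Finset.Icc 1 lΔ, ∑ k ∈ Finset.Icc 1 K, e k j ≤ 52 * d * ι * b * 2 ^ j := by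
    intro j hj
    simp only [he]
    rw [Finset.sum_add_distrib, ← Finset.sum_filter, ← Finset.sum_filter, Finset.sum_const,
      Finset.sum_const, nsmul_eq_mul, nsmul_eq_mul]
    have h3 : (((Finset.Icc 1 K).filter fun k => tag k = some j).card : ℝ) ≤ 3 * d * 4 ^ j * ι :=
      hcard j (Finset.mem_Icc.1 hj).1 (Finset.mem_Icc.1 hj).2
    have h4 : (((Finset.Icc 1 K).filter fun k => k ≤ 4 ^ j * d).card : ℝ) ≤ 4 ^ j * d * ι := by
      refine le_trans (by exact_mod_cast card_Icc_filter_le K (4 ^ j * d))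
        (le_mul_of_one_le_right (by positivity) hι)
    calc _ ≤ 3 * d * 4 ^ j * ι * (16 * b * (1 / 2 : ℝ) ^ j)
          + 4 ^ j * d * ι * (4 * b * (1 / 2 : ℝ) ^ j) := by gcongr
      _ = 52 * d * ι * b * (4 ^ j * (1 / 2) ^ j) := by ring
      _ = _ := by rw [hpow]
  calc ∑ k ∈ Finset.Icc 1 K, g k ≤ ∑ k ∈ Finset.Icc 1 K, ∑ j ∈ Finset.Icc 1 lΔ, e k j :=
        Finset.sum_le_sum h1
    _ = ∑ j ∈ Finset.Icc 1 lΔ, ∑ k ∈ Finset.Icc 1 K, e k j := Finset.sum_comm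
    _ ≤ ∑ j ∈ Finset.Icc 1 lΔ, 52 * d * ι * b * 2 ^ j := Finset.sum_le_sum h2
    _ = 52 * d * ι * b * ∑ j ∈ Finset.Icc 1 lΔ, 2 ^ j := by rw [Finset.mul_sum]
    _ ≤ 52 * d * ι * b * (2 * 2 ^ lΔ) := by gcongr; exact sum_Icc_two_pow_le lΔ
    _ = _ := by ring

lemma inner_eq_dotProduct (v θ : Arm d) : inner ℝ v θ = v.ofLp ⬝ᵥ θ.ofLp := by
  rw [EuclideanSpace.inner_eq_star_dotProduct, star_trivial, dotProduct_comm]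

variable {D : ℕ → Set (Arm d)} {x : ℕ → Arm d} {ε : ℕ → ℝ} {tag : ℕ → Option ℕ}
  {r : Arm d → ℝ} {θ : Arm d}

lemma IsRun.abs_estimate_sub_le {β : ℕ → ℝ} (hd : 0 < d) (hR : 0 ≤ R) (hL : 1 ≤ L) (hB : 1 ≤ B)
    (hζ : 0 ≤ ζ) (hδ : 0 < δ) (hδ1 : δ < 1) (hθ : ‖θ‖ ≤ B)
    (harm : ∀ k ∈ Finset.Icc 1 K, ∀ v ∈ D k, ‖v‖ ≤ L ∧ 0 ≤ r v ∧ r v ≤ 1 ∧ |r v - inner ℝ v θ| ≤ ζ)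
    (hrun : IsRun (B ^ (-2 : ℤ)) β K D x (fun k => r (x k) + ε k) tag)
    {k j : ℕ} (hk : k ≤ K) (hj : 1 ≤ j) (hjl : j ≤ lΔ)
    (hnoise : noiseEnergy (B ^ (-2 : ℤ)) x ε (regressionSet tag k j)
      ≤ R ^ 2 * (Real.log ((gram (B ^ (-2 : ℤ)) x (regressionSet tag k j)).det / (B ^ (-2 : ℤ)) ^ d)
        + 2 * Real.log (1 / (δ * (1 / 2) ^ j))))
    {v : Arm d} (hv : |r v - inner ℝ v θ| ≤ ζ)
    (hsmall : uncertainty (B ^ (-2 : ℤ)) x (regressionSet tag k j) v < (1 / 2 : ℝ) ^ j) :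
    |v.ofLp ⬝ᵥ ridge (B ^ (-2 : ℤ)) x (fun k => r (x k) + ε k) (regressionSet tag k j) - r v|
      ≤ radius d R L B δ j * uncertainty (B ^ (-2 : ℤ)) x (regressionSet tag k j) v
        + ζ * (1 + 4 * √(d * iota1 L B lΔ)) := by
  have hx : ∀ i ∈ Finset.Icc 1 K, ‖x i‖ ≤ L := fun i hi => (harm i hi _ (hrun.mem hi)).1
  have hrad := hrun.noise_radius_le hd hL hB hδ hδ1 hx hk hj
  have hcard := hrun.card_regressionSet_le hd hL hB hx hk hj
  set C := regressionSet tag k j with hC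
  have hCK : ∀ i ∈ C, i ∈ Finset.Icc 1 K := fun i hi =>
    Finset.Icc_subset_Icc le_rfl hk (Finset.mem_filter.1 hi).1
  have hun0 : 0 ≤ uncertainty (B ^ (-2 : ℤ)) x C v := Real.sqrt_nonneg _
  have hι := one_le_iota1 hL hB j
  have hι2 : 0 ≤ 2 * d * iota2 L B δ j := by
    refine mul_nonneg (by positivity) (Real.log_nonneg ?_)
    rw [le_div_iff₀ hδ]
    have : (1 : ℝ) ≤ 2 ^ j := one_le_pow₀ (by norm_num)
    have : 0 ≤ 16 * L ^ 2 * B ^ 2 * 8 ^ j * iota1 L B j := by positivity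
    linarith
  have hn : noiseEnergy (B ^ (-2 : ℤ)) x ε C ≤ (R * √(2 * d * iota2 L B δ j)) ^ 2 := by
    rw [mul_pow, Real.sq_sqrt hι2]
    exact hnoise.trans (by gcongr)
  have hmain := abs_dotProduct_ridge_sub_le (by linarith : 0 < B) rfl hζ
    (by positivity : 0 ≤ R * √(2 * d * iota2 L B δ j)) (f := fun i => r (x i)) hθ (C := C) (x := x)
    (fun i hi => by
      rw [← inner_eq_dotProduct]
      exact (harm i (hCK i hi) _ (hrun.mem (hCK i hi))).2.2.2) hn v
  -- Here `√|C|` grows like `2 ^ j` and the uncertainty is below `2 ^ (-j)`, so the bias does not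
  -- depend on the level.
  have hmis : √C.card * uncertainty (B ^ (-2 : ℤ)) x C v ≤ 4 * √(d * iota1 L B lΔ) := by
    have hιm := iota1_mono hL hB hjl
    have hιl := one_le_iota1 hL hB lΔ
    have h2j : (2 : ℝ) ^ j * (1 / 2) ^ j = 1 := by
      rw [← mul_pow]
      norm_num
    have hs : √(C.card : ℝ) ≤ 4 * √(d * iota1 L B lΔ) * 2 ^ j := by
      refine Real.sqrt_le_iff.2 ⟨by positivity, hcard.trans ?_⟩
      rw [mul_pow, mul_pow, Real.sq_sqrt (by positivity)]
      have h4 : (4 : ℝ) ^ j = (2 ^ j) ^ 2 := by rw [← pow_mul, mul_comm, pow_mul]; norm_num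
      rw [← h4]
      calc 3 * d * 4 ^ j * iota1 L B j ≤ 16 * d * 4 ^ j * iota1 L B lΔ := by gcongr; norm_num
        _ = _ := by ring
    calc √C.card * uncertainty (B ^ (-2 : ℤ)) x C v
        ≤ 4 * √(d * iota1 L B lΔ) * 2 ^ j * (1 / 2) ^ j := by gcongr
      _ = _ := by rw [mul_assoc, h2j, mul_one]
  rw [inner_eq_dotProduct] at hv
  have htri := abs_sub_le (v.ofLp ⬝ᵥ ridge (B ^ (-2 : ℤ)) x (fun k => r (x k) + ε k) C)
    (v.ofLp ⬝ᵥ θ.ofLp) (r v)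
  rw [abs_sub_comm (v.ofLp ⬝ᵥ θ.ofLp)] at htri
  have hmis' := mul_le_mul_of_nonneg_left hmis hζ
  unfold radius
  refine (htri.trans (add_le_add hmain hv)).trans ?_
  linarith

lemma IsRun.regret_le (hd : 0 < d) (hR : 0 ≤ R) (hL : 1 ≤ L) (hB : 1 ≤ B)
    (hζ : 0 ≤ ζ) (hΔ : 0 < Δ) (hδ : 0 < δ) (hδ1 : δ < 1)
    (hcrit : IsCriticalLevel (radius d R L B δ) Δ lΔ)
    (hmis : 4 * lΔ * ζ * (1 + 4 * √(d * iota1 L B lΔ)) < Δ) (hθ : ‖θ‖ ≤ B)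
    (harm : ∀ k ∈ Finset.Icc 1 K, ∀ v ∈ D k, ‖v‖ ≤ L ∧ 0 ≤ r v ∧ r v ≤ 1 ∧ |r v - inner ℝ v θ| ≤ ζ)
    (hgap : ∀ k ∈ Finset.Icc 1 K, ∀ v ∈ D k, 0 < gap r (D k) v → Δ ≤ gap r (D k) v)
    (hrun : IsRun (B ^ (-2 : ℤ)) (radius d R L B δ) K D x (fun k => r (x k) + ε k) tag)
    (hnoise : ∀ j, 1 ≤ j → ∀ k ≤ K, noiseEnergy (B ^ (-2 : ℤ)) x ε (regressionSet tag k j)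
      ≤ R ^ 2 * (Real.log ((gram (B ^ (-2 : ℤ)) x (regressionSet tag k j)).det / (B ^ (-2 : ℤ)) ^ d)
        + 2 * Real.log (1 / (δ * (1 / 2) ^ j)))) :
    regret r K D x ≤ regretBound d R L B δ Δ lΔ := by
  have hx : ∀ i ∈ Finset.Icc 1 K, ‖x i‖ ≤ L := fun i hi => (harm i hi _ (hrun.mem hi)).1
  have hspec := fun k hk => optReward_spec (r := r) ⟨x k, hrun.mem (K := K) (k := k) hk⟩
    fun v hv => ⟨(harm k hk v hv).2.1, (harm k hk v hv).2.2.1⟩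
  have hβ1 : ∀ j, 1 ≤ radius d R L B δ j := one_le_radius hR
  have hβmono : Monotone (radius d R L B δ) := radius_mono hR hL hB hδ
  have hι := one_le_iota1 hL hB lΔ
  have hlΔ : 0 < lΔ := hcrit.1.1
  have hlΔ1 : (1 : ℝ) ≤ lΔ := by exact_mod_cast hlΔ
  -- Rewards lie in `[0, 1]`, so for `Δ > 1` no gap is positive.
  rcases lt_or_ge 1 Δ with hΔ1 | hΔ1
  · refine le_trans (Finset.sum_nonpos fun k hk => not_lt.1 fun h0 => ?_)
      (regretBound_nonneg hL hB hΔ)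
    have h1 := hgap k hk _ (hrun.mem hk) h0
    have h2 := ((hspec k hk).1 _ (hrun.mem hk)).2
    linarith
  · set z := ζ * (1 + 4 * √(d * iota1 L B lΔ)) with hz
    have hz0 : 0 ≤ z := by positivity
    have hz4 : 4 * z < Δ := by
      have h1 : 4 * lΔ * ζ * (1 + 4 * √(d * iota1 L B lΔ)) = 4 * (lΔ * z) := by rw [hz]; ring
      have h2 : z ≤ lΔ * z := le_mul_of_one_le_left hz0 hlΔ1
      linarith
    set b := radius d R L B δ lΔ with hb
    have hb1 : 1 ≤ b := hβ1 lΔ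
    have hcases : ∀ k ∈ Finset.Icc 1 K, gap r (D k) (x k) = 0 ∨ ∃ j ∈ Finset.Icc 1 lΔ,
        (tag k = some j ∧ gap r (D k) (x k) ≤ 16 * b * (1 / 2 : ℝ) ^ j) ∨
        (k ≤ 4 ^ j * d ∧ gap r (D k) (x k) ≤ 4 * b * (1 / 2 : ℝ) ^ j) := by
      intro k hk
      have hkK : k - 1 ≤ K := (Nat.sub_le _ _).trans (Finset.mem_Icc.1 hk).2
      refine (hrun k hk).gap_cases (fun j => zero_le_one.trans (hβ1 j)) (fun j hj => hβmono hj) hz4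
        (hcrit.lt (by linarith) hΔ) (fun j hj hjl v hv hs => ?_) (hgap k hk)
        (fun v hv => ((hspec k hk).1 v hv).1) le_rfl subset_rfl (fun _ => ?_) (fun _ v hv => ?_)
        (fun h => by omega)
      · exact hrun.abs_estimate_sub_le hd hR hL hB hζ hδ hδ1 hθ harm hkK hj hjl
          (hnoise j hj _ hkK) (harm k hk v hv).2.2.2 hs
      · exact exists_gap_eq_zero hΔ ⟨x k, hrun.mem hk⟩
          (fun v hv => ⟨(harm k hk v hv).2.1, (harm k hk v hv).2.2.1⟩) (hgap k hk)
      -- At level one the invariant reads gap at most `8 * b`, and gaps are at most one.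
      · have := ((hspec k hk).1 v hv).2
        linarith
    have hcard : ∀ l, 1 ≤ l → l ≤ lΔ →
        ((regressionSet tag K l).card : ℝ) ≤ 3 * d * 4 ^ l * iota1 L B lΔ := fun l hl hll =>
      (hrun.card_regressionSet_le hd hL hB hx le_rfl hl).trans (by
        have := iota1_mono hL hB hll
        gcongr)
    have hsum := sum_gap_le (d := d) (by linarith : 0 ≤ b) hcard hι hcases
    have hpow := hcrit.pow_le hβ1 hβmono hΔ hΔ1
    refine hsum.trans ?_
    rw [regretBound, le_div_iff₀ hΔ, ← hb]
    calc 104 * d * iota1 L B lΔ * b * 2 ^ lΔ * Δ = 104 * d * iota1 L B lΔ * b * (2 ^ lΔ * Δ) := by ring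
      _ ≤ 104 * d * iota1 L B lΔ * b * (16 * b) := by gcongr
      _ = 1664 * (d * b ^ 2 * iota1 L B lΔ) := by ring
      _ ≤ 2560 * (d * b ^ 2 * iota1 L B lΔ) := by gcongr; norm_num
      _ = _ := by ring

end RegretBound

/-! ### Union bound over the levels -/

section Probability

variable {d : ℕ} {Ω : Type u} {mΩ : MeasurableSpace Ω} {μ : Measure Ω} {𝓕 : Filtration ℕ mΩ} {K : ℕ}
  {x : ℕ → Ω → Arm d} {tag : ℕ → Ω → Option ℕ} {ε : ℕ → Ω → ℝ}

lemma exists_noiseEnergy_le [IsProbabilityMeasure μ] {reg δ R : ℝ} (hreg : 0 < reg) (hδ : 0 < δ)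
    (hR : 0 ≤ R)
    (hx : ∀ k ∈ Finset.Icc 1 K, Measurable[𝓕 (k - 1)] (x k))
    (ht : ∀ k ∈ Finset.Icc 1 K, ∀ l : ℕ, MeasurableSet[𝓕 (k - 1)] {ω | tag k ω = some l})
    (hε : ∀ k ∈ Finset.Icc 1 K, Measurable[𝓕 k] (ε k))
    (hsub : ∀ k ∈ Finset.Icc 1 K, CondSubGaussian (𝓕 (k - 1)) μ R (ε k)) :
    ∃ G : Set Ω, MeasurableSet G ∧ 1 - δ ≤ μ.real G ∧ ∀ ω ∈ G, ∀ j, 1 ≤ j → ∀ k ≤ K,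
      noiseEnergy reg (fun i => x i ω) (fun i => ε i ω) (regressionSet (fun i => tag i ω) k j)
        ≤ R ^ 2 * (Real.log ((gram reg (fun i => x i ω) (regressionSet (fun i => tag i ω) k j)).det
            / reg ^ d) + 2 * Real.log (1 / (δ * (1 / 2) ^ j))) := by
  -- Levels start at one, so the index is shifted; the failure probabilities `δ / 2 ^ (j + 1)` sum
  -- exactly to `δ`.
  choose N hN hμN h using fun j : ℕ => exists_selfNormalized (μ := μ) (δ := δ * (1 / 2) ^ (j + 1))
    hreg (by positivity) hR hx ht hε hsub (j + 1)
  refine ⟨(⋃ j, N j)ᶜ, (MeasurableSet.iUnion hN).compl, ?_, fun ω hω j hj k hk => ?_⟩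
  · have h1 : μ (⋃ j, N j) ≤ ENNReal.ofReal δ := by
      have hs : HasSum (fun j : ℕ => δ * (1 / 2 : ℝ) ^ (j + 1)) δ := by
        have := (hasSum_geometric_two' δ)
        convert this using 2 with j
        rw [pow_succ, one_div_pow]
        field_simp
      calc μ (⋃ j, N j) ≤ ∑' j, μ (N j) := measure_iUnion_le _
        _ ≤ ∑' j : ℕ, ENNReal.ofReal (δ * (1 / 2) ^ (j + 1)) := ENNReal.tsum_le_tsum hμN
        _ = ENNReal.ofReal (∑' j : ℕ, δ * (1 / 2 : ℝ) ^ (j + 1)) :=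
          (ENNReal.ofReal_tsum_of_nonneg (fun j => by positivity) hs.summable).symm
        _ = ENNReal.ofReal δ := by rw [hs.tsum_eq]
    rw [measureReal_compl (MeasurableSet.iUnion hN), probReal_univ]
    have h2 : μ.real (⋃ j, N j) ≤ δ := ENNReal.toReal_le_of_le_ofReal hδ.le h1
    linarith
  · obtain ⟨i, rfl⟩ : ∃ i, j = i + 1 := ⟨j - 1, by omega⟩
    exact h i ω (fun hmem => hω (Set.mem_iUnion.2 ⟨i, hmem⟩)) k hk

end Probability

/-! ### Explicit form of the bound -/

section Asymptotic

variable {d : ℕ} {R L B Δ δ : ℝ} {l : ℕ}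

lemma log_parameters (hd : 0 < d) (hR : 0 ≤ R) (hL : 1 ≤ L) (hB : 1 ≤ B) (hδ : 0 < δ)
    (hδ1 : δ < 1) :
    Real.log (d * L * B * (1 + R) / δ)
        = Real.log d + Real.log L + Real.log B + Real.log (1 + R) + Real.log (1 / δ) ∧
      0 ≤ Real.log d ∧ 0 ≤ Real.log L ∧ 0 ≤ Real.log B ∧ 0 ≤ Real.log (1 + R) ∧
      0 ≤ Real.log (1 / δ) := by
  have hd1 : (1 : ℝ) ≤ d := by exact_mod_cast hd
  refine ⟨?_, Real.log_nonneg hd1, Real.log_nonneg hL, Real.log_nonneg hB,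
    Real.log_nonneg (by linarith), Real.log_nonneg (by rw [le_div_iff₀ hδ]; linarith)⟩
  rw [← Real.log_mul (by positivity) (by positivity), ← Real.log_mul (by positivity) (by positivity),
    ← Real.log_mul (by positivity) (by positivity), ← Real.log_mul (by positivity) (by positivity),
    mul_one_div]

lemma iota1_le (hL : 1 ≤ L) (hB : 1 ≤ B) (l : ℕ) :
    iota1 L B l ≤ 2 + Real.log L + Real.log B + l := by
  rw [iota1, Real.log_mul (by positivity) (by positivity), Real.log_mul (by positivity) (by positivity),
    Real.log_mul (by positivity) (by positivity), Real.log_pow]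
  have h1 : Real.log 3 ≤ 2 := by
    have := Real.log_le_sub_one_of_pos (x := 3) (by norm_num)
    linarith
  have h2 : l * Real.log 2 ≤ l := mul_le_of_le_one_right (by positivity) (by linarith [Real.log_two_lt_d9])
  linarith

lemma iota2_le (hL : 1 ≤ L) (hB : 1 ≤ B) (hδ : 0 < δ) (l : ℕ) :
    iota2 L B δ l ≤ 6 + 3 * Real.log L + 3 * Real.log B + Real.log (1 / δ) + 3 * l := by
  have hι := one_le_iota1 hL hB l
  have h1 : iota1 L B l ≤ 3 * L * B * 2 ^ l := Real.log_le_self (by positivity)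
  have hLB := one_le_mul_of_one_le hL hB
  have h2 : (2 : ℝ) ^ l + 16 * L ^ 2 * B ^ 2 * 8 ^ l * iota1 L B l ≤ 64 * L ^ 3 * B ^ 3 * 16 ^ l := by
    have h3 : 16 * L ^ 2 * B ^ 2 * 8 ^ l * iota1 L B l
        ≤ 16 * L ^ 2 * B ^ 2 * 8 ^ l * (3 * L * B * 2 ^ l) := by gcongr
    have h4 : (8 : ℝ) ^ l * 2 ^ l = 16 ^ l := by rw [← mul_pow]; norm_num
    have h5 : 16 * L ^ 2 * B ^ 2 * 8 ^ l * (3 * L * B * 2 ^ l) = 48 * (L ^ 3 * B ^ 3 * 16 ^ l) := by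
      rw [← h4]; ring
    have h6 : (2 : ℝ) ^ l ≤ L ^ 3 * B ^ 3 * 16 ^ l := by
      calc (2 : ℝ) ^ l ≤ 16 ^ l := by gcongr; norm_num
        _ ≤ (L ^ 3 * B ^ 3) * 16 ^ l := le_mul_of_one_le_left (by positivity) (by
          rw [← mul_pow]; exact one_le_pow₀ hLB)
    have h7 : 0 ≤ L ^ 3 * B ^ 3 * 16 ^ l := by positivity
    linarith
  have h3 : iota2 L B δ l ≤ Real.log (64 * L ^ 3 * B ^ 3 * 16 ^ l * (1 / δ)) := by
    rw [iota2, mul_one_div]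
    refine Real.log_le_log (by positivity) ?_
    gcongr
  refine h3.trans ?_
  rw [Real.log_mul (by positivity) (by positivity), Real.log_mul (by positivity) (by positivity),
    Real.log_mul (by positivity) (by positivity), Real.log_mul (by positivity) (by positivity),
    Real.log_pow, Real.log_pow, Real.log_pow]
  have h64 : Real.log 64 = 6 * Real.log 2 := by
    rw [show (64 : ℝ) = 2 ^ 6 by norm_num, Real.log_pow]; norm_num
  have h16 : Real.log 16 = 4 * Real.log 2 := by
    rw [show (16 : ℝ) = 2 ^ 4 by norm_num, Real.log_pow]; norm_num
  have h2lt := Real.log_two_lt_d9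
  have h8 : l * Real.log 16 ≤ l * 3 := mul_le_mul_of_nonneg_left (by linarith) (by positivity)
  push_cast
  linarith

lemma one_le_iota2 (hL : 1 ≤ L) (hB : 1 ≤ B) (hδ : 0 < δ) (hδ1 : δ < 1) (l : ℕ) :
    1 ≤ iota2 L B δ l := by
  have hι := one_le_iota1 hL hB l
  refine one_le_log_three.trans (Real.log_le_log (by norm_num) ?_)
  rw [le_div_iff₀ hδ]
  have h2 : (0 : ℝ) < 2 ^ l := by positivity
  have h8 : (1 : ℝ) ≤ 8 ^ l := one_le_pow₀ (by norm_num)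
  have h3 : 1 ≤ L ^ 2 * B ^ 2 * 8 ^ l * iota1 L B l := by
    have hL2 : 1 ≤ L ^ 2 := one_le_pow₀ hL
    have hB2 : 1 ≤ B ^ 2 := one_le_pow₀ hB
    exact one_le_mul_of_one_le_of_one_le (one_le_mul_of_one_le_of_one_le
      (one_le_mul_of_one_le_of_one_le hL2 hB2) h8) hι
  nlinarith

lemma radius_le (hd : 0 < d) (hL : 1 ≤ L) (hB : 1 ≤ B) (hδ : 0 < δ) (hδ1 : δ < 1)
    (l : ℕ) : radius d R L B δ l ≤ (1 + R) * √(2 * d * iota2 L B δ l) := by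
  have hd1 : (1 : ℝ) ≤ d := by exact_mod_cast hd
  have h1 := one_le_iota2 hL hB hδ hδ1 l
  have h2 : 1 ≤ √(2 * d * iota2 L B δ l) := by
    rw [Real.one_le_sqrt]
    nlinarith
  unfold radius
  linarith

/-- The level `l` enters its own bound through `log β`, but only via `log iota2`, so a tangent line
lets the left side absorb it. -/
lemma IsCriticalLevel.le_log (hd : 0 < d) (hR : 0 ≤ R) (hL : 1 ≤ L) (hB : 1 ≤ B) (hΔ : 0 < Δ)
    (hδ : 0 < δ) (hδ1 : δ < 1) (h : IsCriticalLevel (radius d R L B δ) Δ l) :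
    (l : ℝ) ≤ 8 * (1 + Real.log (d * L * B * (1 + R) / δ) + Real.log (1 + 1 / Δ)) := by
  obtain ⟨hQ, h1, h2, h3, h4, h5⟩ := log_parameters hd hR hL hB hδ hδ1
  have hT : 0 ≤ Real.log (1 + 1 / Δ) := Real.log_nonneg (le_add_of_nonneg_right (by positivity))
  by_cases hl : l = 1
  · subst hl
    push_cast
    linarith
  · obtain ⟨j, rfl, hj⟩ := h.le_logb hl
    have hd' : (0 : ℝ) < d := by exact_mod_cast hd
    have hι := one_le_iota2 hL hB hδ hδ1 j
    have hβ := one_le_radius (d := d) (L := L) (B := B) (δ := δ) hR j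
    have hl2 : 0 < Real.log 2 := Real.log_pos (by norm_num)
    have hl2' := Real.log_two_lt_d9
    have hl2'' := Real.log_two_gt_d9
    have hlog8 : Real.log 8 = 3 * Real.log 2 := by
      rw [show (8 : ℝ) = 2 ^ 3 by norm_num, Real.log_pow]; norm_num
    rw [Real.logb, le_div_iff₀ hl2, ← mul_one_div, Real.log_mul (by positivity) (by positivity),
      Real.log_mul (by positivity) (by positivity), hlog8] at hj
    have h6 : Real.log (1 / Δ) ≤ Real.log (1 + 1 / Δ) :=
      Real.log_le_log (by positivity) (by linarith)
    have h7 : Real.log (radius d R L B δ j)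
        ≤ Real.log (1 + R) + (Real.log 2 + Real.log d + Real.log (iota2 L B δ j)) / 2 := by
      refine (Real.log_le_log (by linarith) (radius_le hd hL hB hδ hδ1 j)).trans_eq ?_
      rw [Real.log_mul (by positivity) (by positivity), Real.log_sqrt (by positivity),
        Real.log_mul (by positivity) (by positivity), Real.log_mul (by positivity) (by positivity)]
    -- Tangent at `8`: after the square root, `iota2 / 16` contributes `3 j / 16`, well below `j *
    -- log 2`.
    have h8 : Real.log (iota2 L B δ j) ≤ 3 * Real.log 2 + iota2 L B δ j / 8 - 1 := by
      have := Real.log_le_sub_one_of_pos (x := iota2 L B δ j / 8) (by positivity)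
      rw [Real.log_div (by positivity) (by norm_num), hlog8] at this
      linarith
    have h9 := iota2_le hL hB hδ j
    have h10 : (j : ℝ) * 0.69 ≤ j * Real.log 2 :=
      mul_le_mul_of_nonneg_left (by linarith) (by positivity)
    push_cast
    linarith

lemma regretBound_le (hd : 0 < d) (hR : 0 ≤ R) (hL : 1 ≤ L) (hB : 1 ≤ B) (hΔ : 0 < Δ)
    (hδ : 0 < δ) (hδ1 : δ < 1) (h : IsCriticalLevel (radius d R L B δ) Δ l) :
    regretBound d R L B δ Δ l ≤ 1536000 * (1 + R) ^ 2 * (d ^ 2 / Δ) *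
      (1 + Real.log (d * L * B * (1 + R) / δ) + Real.log (1 + 1 / Δ)) ^ 2 := by
  obtain ⟨hQ, h1, h2, h3, h4, h5⟩ := log_parameters hd hR hL hB hδ hδ1
  have hT : 0 ≤ Real.log (1 + 1 / Δ) := Real.log_nonneg (le_add_of_nonneg_right (by positivity))
  have hl := h.le_log hd hR hL hB hΔ hδ hδ1
  have hι1 := iota1_le hL hB l
  have hι2 := iota2_le hL hB hδ l
  have hι1' := one_le_iota1 hL hB l
  have hι2' := one_le_iota2 hL hB hδ hδ1 l
  set Λ := 1 + Real.log (d * L * B * (1 + R) / δ) + Real.log (1 + 1 / Δ) with hΛ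
  have h6 : iota1 L B l ≤ 10 * Λ := by linarith
  have h7 : iota2 L B δ l ≤ 30 * Λ := by linarith
  have hΛ0 : 0 ≤ Λ := by linarith
  have hβ : radius d R L B δ l ^ 2 ≤ (1 + R) ^ 2 * (2 * d * iota2 L B δ l) := by
    have hβ1 := one_le_radius (d := d) (L := L) (B := B) (δ := δ) hR l
    refine (pow_le_pow_left₀ (by linarith) (radius_le hd hL hB hδ hδ1 l) 2).trans_eq ?_
    rw [mul_pow, Real.sq_sqrt (by positivity)]
  -- The constant is `2560 * 2 * 30 * 10 = 1536000`.
  calc regretBound d R L B δ Δ l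
      ≤ 2560 * d * ((1 + R) ^ 2 * (2 * d * (30 * Λ))) * (10 * Λ) / Δ := by
        unfold regretBound
        have : (1 + R) ^ 2 * (2 * d * iota2 L B δ l) ≤ (1 + R) ^ 2 * (2 * d * (30 * Λ)) := by gcongr
        gcongr
        exact hβ.trans this
    _ = _ := by ring

end Asymptotic

end SupLinUCB

theorem theorem2 :
    -- an absolute constant, used only in the `Õ (d² / Δ)` form of the bound
    ∃ c : ℝ, ∀ (d : ℕ) (R L B ζ Δ δ : ℝ) (lΔ : ℕ),
      0 < d → 0 ≤ R → 1 ≤ L → 1 ≤ B → 0 ≤ ζ → 0 < Δ → 0 < δ → δ < 1 →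
      SupLinUCB.IsCriticalLevel (SupLinUCB.radius d R L B δ) Δ lΔ →
      -- the regret bound, for every number of rounds and every environment
      (4 * lΔ * ζ * (1 + 4 * √(d * SupLinUCB.iota1 L B lΔ)) < Δ →
        ∀ (K : ℕ) (Ω : Type u) [mΩ : MeasurableSpace Ω] (μ : Measure Ω) [IsProbabilityMeasure μ]
          (𝓕 : Filtration ℕ mΩ)
          (D : ℕ → Ω → Set (SupLinUCB.Arm d)) (r : SupLinUCB.Arm d → ℝ) (θ : SupLinUCB.Arm d)
          (x : ℕ → Ω → SupLinUCB.Arm d) (tag : ℕ → Ω → Option ℕ) (ε : ℕ → Ω → ℝ),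
          -- a linear bandit with misspecification level `ζ`
          ‖θ‖ ≤ B →
          (∀ k ∈ Finset.Icc 1 K, ∀ ω, ∀ v ∈ D k ω,
            ‖v‖ ≤ L ∧ 0 ≤ r v ∧ r v ≤ 1 ∧ |r v - inner ℝ v θ| ≤ ζ) →
          -- every positive sub-optimality gap is at least `Δ`
          (∀ k ∈ Finset.Icc 1 K, ∀ ω, ∀ v ∈ D k ω,
            0 < SupLinUCB.gap r (D k ω) v → Δ ≤ SupLinUCB.gap r (D k ω) v) →
          -- the decisions of round `k` are made before its noise, which is `R`-sub-Gaussian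
          (∀ k ∈ Finset.Icc 1 K,
            Measurable[𝓕 (k - 1)] (x k) ∧
            (∀ l : ℕ, MeasurableSet[𝓕 (k - 1)] {ω | tag k ω = some l}) ∧
            Measurable[𝓕 k] (ε k) ∧
            SupLinUCB.CondSubGaussian (𝓕 (k - 1)) μ R (ε k)) →
          -- the arms are chosen by SupLinUCB with `λ = B⁻²` and radius `β`
          (∀ ω, SupLinUCB.IsRun (B ^ (-2 : ℤ)) (SupLinUCB.radius d R L B δ) K
            (fun k => D k ω) (fun k => x k ω) (fun k => r (x k ω) + ε k ω) (fun k => tag k ω)) →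
          -- with probability at least `1 - δ`
          ∃ G : Set Ω, MeasurableSet G ∧ 1 - δ ≤ μ.real G ∧
            ∀ ω ∈ G, SupLinUCB.regret r K (fun k => D k ω) (fun k => x k ω)
              ≤ SupLinUCB.regretBound d R L B δ Δ lΔ) ∧
      -- the bound does not involve `K` and is `Õ (d² / Δ)`
      SupLinUCB.regretBound d R L B δ Δ lΔ ≤
        c * (1 + R) ^ 2 * (d ^ 2 / Δ) *
          (1 + Real.log (d * L * B * (1 + R) / δ) + Real.log (1 + 1 / Δ)) ^ 2 := by
  refine ⟨1536000, fun d R L B ζ Δ δ lΔ hd hR hL hB hζ hΔ hδ hδ1 hcrit =>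
    ⟨fun hmis K Ω mΩ μ _ 𝓕 D r θ x tag ε hθ harm hgap hadapt hrun => ?_,
      SupLinUCB.regretBound_le hd hR hL hB hΔ hδ hδ1 hcrit⟩⟩
  obtain ⟨G, hG, hμG, hnoise⟩ := SupLinUCB.exists_noiseEnergy_le
    (SupLinUCB.zpow_neg_two_pos hB) hδ hR (fun k hk => (hadapt k hk).1)
    (fun k hk => (hadapt k hk).2.1) (fun k hk => (hadapt k hk).2.2.1)
    (fun k hk => (hadapt k hk).2.2.2)
  exact ⟨G, hG, hμG, fun ω hω => (hrun ω).regret_le hd hR hL hB hζ hΔ hδ hδ1 hcrit hmis hθ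
    (fun k hk => harm k hk ω) (fun k hk => hgap k hk ω) (hnoise ω hω)⟩
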